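/- Let $(M,J,g)$ be an almost skew-Hermitian manifold: $M$ is a smooth manifold (of dimension $2n$), $g$ is a smooth pseudo-Riemannian metric and $J$ is a smooth almost complex structure with $g(JX,JY)=-g(X,Y)$. Let $\nabla$ be the Levi-Civita connection of $g$, and put $$R(X,Y)Z=\nabla_X\nabla_YZ-\nabla_Y\nabla_XZ-\nabla_{[X,Y]}Z,\qquad R(X,Y,Z,W)=g(R(X,Y)Z,W),\qquad F(X,Y,Z)=g((\nabla_XJ)Y,Z).$$ For a vector field $X$ on $M$ let $X^V$ and $X^H$ be its vertical lift and its horizontal lift (with respect to $\nabla$) to the tangent bundle $TM$; in induced coordinates $(x^k,y^k)$ these have components $(0,X^k)$ and $(X^k,-y^i\Gamma_{ij}^kX^j)$. Define on $TM$ the almost complex structures $$J_1:\ X^H\mapsto X^V,\ X^V\mapsto -X^H;\qquad J_2:\ X^H\mapsto (JX)^V,\ X^V\mapsto (JX)^H;\qquad J_3=J_1\circ J_2,$$ and the Sasaki metric $\hat g(X^H,Y^H)=\hat g(X^V,Y^V)=g(X,Y)$, $\hat g(X^H,Y^V)=0$. Let $\hat\nabla$ be the Levi-Civita connection of $\hat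 g$, and let $F_\alpha(A,B,C)=\hat g((\hat\nabla_AJ_\alpha)B,C)$ for $\alpha=1,2,3$. Then for all smooth vector fields $X,Y,Z$ on $M$ and at every $u\in T_pM$, $p\in M$, the following holds. For $F_1$: $$-F_1(X^H,Y^H,Z^H)=F_1(X^H,Y^V,Z^V)=F_1(X^V,Y^H,Z^V)=F_1(X^V,Y^V,Z^H)=\tfrac12R(Y,Z,X,u).$$ For $F_2$: $$F_2(X^H,Y^H,Z^H)=-\tfrac12R(X,Y,JZ,u)+\tfrac12R(Z,X,JY,u),$$ $$F_2(X^H,Y^V,Z^V)=\tfrac12R(X,JY,Z,u)-\tfrac12R(JZ,X,Y,u),$$ $$F_2(X^H,Y^H,Z^V)=F_2(X^H,Y^V,Z^H)=F(X,Y,Z),$$ $$F_2(X^V,Y^H,Z^V)=\tfrac12R(Y,JZ,X,u),\qquad F_2(X^V,Y^V,Z^H)=-\tfrac12R(JY,Z,X,u).$$ For $F_3$: $$F_3(X^H,Y^H,Z^H)=-F_3(X^H,Y^V,Z^V)=-F(X,Y,Z),$$ $$F_3(X^H,Y^H,Z^V)=-\tfrac12R(X,JY,Z,u)-\tfrac12R(X,Y,JZ,u),$$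 $$F_3(X^H,Y^V,Z^H)=\tfrac12R(Z,X,JY,u)+\tfrac12R(JZ,X,Y,u),$$ $$F_3(X^V,Y^H,Z^H)=\tfrac12R(JY,Z,X,u)-\tfrac12R(Y,JZ,X,u).$$ For each $\alpha$, the components of $F_\alpha$ on triples of horizontal and vertical lifts of $X,Y,Z$ (in this order) that are not listed above are zero. -/

import Mathlib

set_option maxSynthPendingDepth 3

open scoped Manifold ContDiff Topology

noncomputable section

namespace SasakiLift

section Connection

variable {E : Type*} [NormedAddCommGroup E] [NormedSpace ℝ E]
  {H : Type*} [TopologicalSpace H] {I : ModelWithCorners ℝ E H}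
  {N : Type*} [TopologicalSpace N] [ChartedSpace H N] [IsManifold I 1 N]

/-- The matrix `g_{ij}` of a `(0,2)`-tensor field `g` with respect to the coordinate frame of the
chart at `p`, as a function of the point `q` (with values in the bilinear forms on the model
space). It is meaningful for `q` in the domain of that chart; at `q = p` it is `g p` itself. -/
def metricInChart (g : Π x : N, TangentSpace I x →L[ℝ] TangentSpace I x →L[ℝ] ℝ) (p q : N) :
    E →L[ℝ] E →L[ℝ] ℝ :=
  let e : E →L[ℝ] E := (trivializationAt E (TangentSpace I) p).symmL ℝ q
  let b : E →L[ℝ] E →L[ℝ] ℝ := g q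
  b.bilinearComp e e

/-- The partial derivatives of the metric coefficients in the chart at `p`, evaluated at `p`:
`metricDeriv g p a b c = ∂_a (g (b, c))` for constant coefficient vectors `a`, `b`, `c`. -/
def metricDeriv (g : Π x : N, TangentSpace I x →L[ℝ] TangentSpace I x →L[ℝ] ℝ) (p : N) :
    E →L[ℝ] E →L[ℝ] E →L[ℝ] ℝ :=
  mvfderiv I (metricInChart g p) p

/-- The Christoffel symbols of the first kind in the chart at `p`, evaluated at `p`:
`½ (∂_a g(b, c) + ∂_b g(a, c) - ∂_c g(a, b))`. -/
def christoffelFirst (g : Π x : N, TangentSpace I x →L[ℝ] TangentSpace I x →L[ℝ] ℝ) (p : N) :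
    E →L[ℝ] E →L[ℝ] E →L[ℝ] ℝ :=
  let D₁ : E →L[ℝ] E →L[ℝ] E →L[ℝ] ℝ := metricDeriv g p
  let D₂ : E →L[ℝ] E →L[ℝ] E →L[ℝ] ℝ := D₁.flip
  let σ : (E →L[ℝ] E →L[ℝ] ℝ) →L[ℝ] (E →L[ℝ] E →L[ℝ] ℝ) :=
    (ContinuousLinearMap.flipₗᵢ ℝ E E ℝ).toContinuousLinearEquiv
  let D₃ : E →L[ℝ] E →L[ℝ] E →L[ℝ] ℝ := σ.comp D₂
  let S : E →L[ℝ] E →L[ℝ] E →L[ℝ] ℝ := D₁ + D₂ - D₃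
  (1 / 2 : ℝ) • S

theorem christoffelFirst_apply
    (g : Π x : N, TangentSpace I x →L[ℝ] TangentSpace I x →L[ℝ] ℝ) (p : N) (a b c : E) :
    christoffelFirst g p a b c =
      (1 / 2 : ℝ) * (metricDeriv g p a b c + metricDeriv g p b a c - metricDeriv g p c a b) := by
  simp [christoffelFirst]

/-- The Christoffel symbols `Γ(a, b)^k = Γ_{ij}^k a^i b^j` of the pseudo-Riemannian metric `g` in
the chart at `p`, evaluated at `p`: the first-kind symbols with an index raised by `g p`. -/
def christoffel (g : Π x : N, TangentSpace I x →L[ℝ] TangentSpace I x →L[ℝ] ℝ) (p : N) :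
    E →L[ℝ] E →L[ℝ] E :=
  let b : E →L[ℝ] (E →L[ℝ] ℝ) := g p
  (ContinuousLinearMap.compL ℝ E (E →L[ℝ] ℝ) E b.inverse).comp (christoffelFirst g p)

/-- The Levi-Civita connection of the pseudo-Riemannian metric `g`. For a vector field `Y`, a
point `p` and a tangent vector `v` at `p`, `leviCivita g Y p v` is `(∇_v Y)(p)`, that is
`v^i (∂_i Y^k + Γ_{ij}^k Y^j)` in the chart at `p`. -/
def leviCivita (g : Π x : N, TangentSpace I x →L[ℝ] TangentSpace I x →L[ℝ] ℝ)
    (Y : Π x : N, TangentSpace I x) (p : N) : TangentSpace I p →L[ℝ] TangentSpace I p :=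
  let Yp : N → E := fun q ↦ (trivializationAt E (TangentSpace I) p ⟨q, Y q⟩).2
  let D : E →L[ℝ] E := mvfderiv I Yp p
  let Γ : E →L[ℝ] E := (christoffel g p).flip (Y p)
  D + Γ

/-- The vector field `∇_X Y`. -/
def nabla (g : Π x : N, TangentSpace I x →L[ℝ] TangentSpace I x →L[ℝ] ℝ)
    (X Y : Π x : N, TangentSpace I x) : Π x : N, TangentSpace I x :=
  fun p ↦ leviCivita g Y p (X p)

/-- The curvature operator `R(X,Y)Z = ∇_X ∇_Y Z - ∇_Y ∇_X Z - ∇_{[X,Y]} Z`. -/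
def curvature (g : Π x : N, TangentSpace I x →L[ℝ] TangentSpace I x →L[ℝ] ℝ)
    (X Y Z : Π x : N, TangentSpace I x) : Π x : N, TangentSpace I x :=
  fun p ↦ nabla g X (nabla g Y Z) p - nabla g Y (nabla g X Z) p -
    nabla g (VectorField.mlieBracket I X Y) Z p

/-- The curvature `(0,4)`-tensor `R(X,Y,Z,w) = g(R(X,Y)Z, w)` at `p`, where the last argument is
a tangent vector at `p`. -/
def curvature₄ (g : Π x : N, TangentSpace I x →L[ℝ] TangentSpace I x →L[ℝ] ℝ)
    (X Y Z : Π x : N, TangentSpace I x) (p : N) (w : TangentSpace I p) : ℝ :=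
  g p (curvature g X Y Z p) w

/-- The action `JX` of a field of endomorphisms on a vector field. -/
def act (J : Π x : N, TangentSpace I x →L[ℝ] TangentSpace I x)
    (X : Π x : N, TangentSpace I x) : Π x : N, TangentSpace I x :=
  fun p ↦ J p (X p)

/-- The structural tensor `F(X,Y,Z) = g((∇_X J)Y, Z)`, where `(∇_X J)Y = ∇_X(JY) - J(∇_X Y)`. -/
def structuralTensor (g : Π x : N, TangentSpace I x →L[ℝ] TangentSpace I x →L[ℝ] ℝ)
    (J : Π x : N, TangentSpace I x →L[ℝ] TangentSpace I x)
    (X Y Z : Π x : N, TangentSpace I x) (p : N) : ℝ :=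
  g p (nabla g X (act J Y) p - J p (nabla g X Y p)) (Z p)

end Connection

section Base

variable {E : Type*} [NormedAddCommGroup E] [NormedSpace ℝ E]
  {M : Type*} [TopologicalSpace M] [ChartedSpace E M] [IsManifold 𝓘(ℝ, E) ∞ M]

variable (E M) in
/-- An almost skew-Hermitian structure `(J, g)` on `M`: a smooth pseudo-Riemannian metric `g` and
a smooth almost complex structure `J` which acts as an anti-isometry on each tangent space.
(The signature of `g` is then automatically neutral and the dimension of `M` is even.) -/
structure AlmostSkewHermitian where
  /-- the metric -/
  g : Π x : M, TangentSpace 𝓘(ℝ, E) x →L[ℝ] TangentSpace 𝓘(ℝ, E) x →L[ℝ] ℝ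
  /-- the almost complex structure -/
  J : Π x : M, TangentSpace 𝓘(ℝ, E) x →L[ℝ] TangentSpace 𝓘(ℝ, E) x
  symm : ∀ x v w, g x v w = g x w v
  nondegenerate : ∀ x v, (∀ w, g x v w = 0) → v = 0
  smooth_g : ContMDiff 𝓘(ℝ, E) (𝓘(ℝ, E).prod 𝓘(ℝ, E →L[ℝ] E →L[ℝ] ℝ)) ∞
    (fun x ↦ Bundle.TotalSpace.mk' (E →L[ℝ] E →L[ℝ] ℝ)
      (E := fun x : M ↦ TangentSpace 𝓘(ℝ, E) x →L[ℝ] TangentSpace 𝓘(ℝ, E) x →L[ℝ] ℝ) x (g x))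
  smooth_J : ContMDiff 𝓘(ℝ, E) (𝓘(ℝ, E).prod 𝓘(ℝ, E →L[ℝ] E)) ∞
    (fun x ↦ Bundle.TotalSpace.mk' (E →L[ℝ] E)
      (E := fun x : M ↦ TangentSpace 𝓘(ℝ, E) x →L[ℝ] TangentSpace 𝓘(ℝ, E) x) x (J x))
  J_sq : ∀ x v, J x (J x v) = -v
  anti_isometry : ∀ x v w, g x (J x v) (J x w) = -g x v w

/-- A smooth vector field on `M`. -/
def IsSmoothField (X : Π x : M, TangentSpace 𝓘(ℝ, E) x) : Prop :=
  ContMDiff 𝓘(ℝ, E) 𝓘(ℝ, E).tangent ∞ (fun x ↦ (⟨x, X x⟩ : TangentBundle 𝓘(ℝ, E) M))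

end Base

section Lifts

/-! The tangent space of `TM` at `u ∈ T_pM` is the model space `E × E`, the components being those
with respect to the chart of `TM` at `u`, which is the chart `(x^k, y^k)` induced from the chart
of `M` at `p`. -/

variable {E : Type*} [NormedAddCommGroup E] [NormedSpace ℝ E]
  {M : Type*} [TopologicalSpace M] [ChartedSpace E M] [IsManifold 𝓘(ℝ, E) ∞ M]
  (g : Π x : M, TangentSpace 𝓘(ℝ, E) x →L[ℝ] TangentSpace 𝓘(ℝ, E) x →L[ℝ] ℝ)
  (J : Π x : M, TangentSpace 𝓘(ℝ, E) x →L[ℝ] TangentSpace 𝓘(ℝ, E) x)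

/-- Vertical lift `T_pM → T_u(TM)`, with components `(0, v^k)` in the induced coordinates. -/
def vert (u : TangentBundle 𝓘(ℝ, E) M) :
    TangentSpace 𝓘(ℝ, E) u.proj →L[ℝ] TangentSpace 𝓘(ℝ, E).tangent u :=
  let A : E →L[ℝ] E × E := ContinuousLinearMap.inr ℝ E E
  A

/-- Horizontal lift `T_pM → T_u(TM)` with respect to the Levi-Civita connection of `g`, with
components `(v^k, -y^i Γ_{ij}^k v^j)` in the induced coordinates, where `u = (y^k)`. -/
def horiz (u : TangentBundle 𝓘(ℝ, E) M) :
    TangentSpace 𝓘(ℝ, E) u.proj →L[ℝ] TangentSpace 𝓘(ℝ, E).tangent u :=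
  let A : E →L[ℝ] E × E :=
    (ContinuousLinearMap.id ℝ E).prod (-(christoffel g u.proj u.snd))
  A

/-- The horizontal part `T_u(TM) → T_pM`, `v^H + w^V ↦ v` (the differential of the projection). -/
def hPart (u : TangentBundle 𝓘(ℝ, E) M) :
    TangentSpace 𝓘(ℝ, E).tangent u →L[ℝ] TangentSpace 𝓘(ℝ, E) u.proj :=
  let A : E × E →L[ℝ] E := ContinuousLinearMap.fst ℝ E E
  A

/-- The vertical part `T_u(TM) → T_pM`, `v^H + w^V ↦ w` (the connection map). -/
def vPart (u : TangentBundle 𝓘(ℝ, E) M) :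
    TangentSpace 𝓘(ℝ, E).tangent u →L[ℝ] TangentSpace 𝓘(ℝ, E) u.proj :=
  let A : E × E →L[ℝ] E := ContinuousLinearMap.snd ℝ E E +
    (christoffel g u.proj u.snd).comp (ContinuousLinearMap.fst ℝ E E)
  A

@[simp] theorem hPart_vert (u : TangentBundle 𝓘(ℝ, E) M) (v : TangentSpace 𝓘(ℝ, E) u.proj) :
    hPart u (vert u v) = 0 := rfl

@[simp] theorem hPart_horiz (u : TangentBundle 𝓘(ℝ, E) M) (v : TangentSpace 𝓘(ℝ, E) u.proj) :
    hPart u (horiz g u v) = v := rfl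

@[simp] theorem vPart_vert (u : TangentBundle 𝓘(ℝ, E) M) (v : TangentSpace 𝓘(ℝ, E) u.proj) :
    vPart g u (vert u v) = v := by
  have h (a : E) : a + christoffel g u.proj u.snd 0 = a := by rw [map_zero, add_zero]
  exact h v

@[simp] theorem vPart_horiz (u : TangentBundle 𝓘(ℝ, E) M) (v : TangentSpace 𝓘(ℝ, E) u.proj) :
    vPart g u (horiz g u v) = 0 :=
  neg_add_cancel (christoffel g u.proj u.snd v)

/-- The vertical lift `X^V` of a vector field. -/
def vertLift (X : Π x : M, TangentSpace 𝓘(ℝ, E) x) :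
    Π u : TangentBundle 𝓘(ℝ, E) M, TangentSpace 𝓘(ℝ, E).tangent u :=
  fun u ↦ vert u (X u.proj)

/-- The horizontal lift `X^H` of a vector field. -/
def horizLift (X : Π x : M, TangentSpace 𝓘(ℝ, E) x) :
    Π u : TangentBundle 𝓘(ℝ, E) M, TangentSpace 𝓘(ℝ, E).tangent u :=
  fun u ↦ horiz g u (X u.proj)

/-- The almost complex structure `J₁` on `TM`: `X^H ↦ X^V`, `X^V ↦ -X^H`. -/
def J₁ (u : TangentBundle 𝓘(ℝ, E) M) :
    TangentSpace 𝓘(ℝ, E).tangent u →L[ℝ] TangentSpace 𝓘(ℝ, E).tangent u :=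
  (vert u).comp (hPart u) - (horiz g u).comp (vPart g u)

/-- The almost complex structure `J₂` on `TM`: `X^H ↦ (JX)^V`, `X^V ↦ (JX)^H`. -/
def J₂ (u : TangentBundle 𝓘(ℝ, E) M) :
    TangentSpace 𝓘(ℝ, E).tangent u →L[ℝ] TangentSpace 𝓘(ℝ, E).tangent u :=
  (vert u).comp ((J u.proj).comp (hPart u)) + (horiz g u).comp ((J u.proj).comp (vPart g u))

/-- The almost complex structure `J₃ = J₁ ∘ J₂` on `TM`. -/
def J₃ (u : TangentBundle 𝓘(ℝ, E) M) :
    TangentSpace 𝓘(ℝ, E).tangent u →L[ℝ] TangentSpace 𝓘(ℝ, E).tangent u :=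
  (J₁ g u).comp (J₂ g J u)

/-- The Sasaki metric on `TM`: `ĝ(X^H,Y^H) = ĝ(X^V,Y^V) = g(X,Y)`, `ĝ(X^H,Y^V) = 0`. -/
def sasaki (u : TangentBundle 𝓘(ℝ, E) M) :
    TangentSpace 𝓘(ℝ, E).tangent u →L[ℝ] TangentSpace 𝓘(ℝ, E).tangent u →L[ℝ] ℝ :=
  let b : E →L[ℝ] E →L[ℝ] ℝ := g u.proj
  let h : E × E →L[ℝ] E := hPart u
  let v : E × E →L[ℝ] E := vPart g u
  let B : E × E →L[ℝ] E × E →L[ℝ] ℝ := b.bilinearComp h h + b.bilinearComp v v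
  B

theorem J₁_horiz (u : TangentBundle 𝓘(ℝ, E) M) (v : TangentSpace 𝓘(ℝ, E) u.proj) :
    J₁ g u (horiz g u v) = vert u v := by
  simp [J₁]

theorem J₁_vert (u : TangentBundle 𝓘(ℝ, E) M) (v : TangentSpace 𝓘(ℝ, E) u.proj) :
    J₁ g u (vert u v) = -horiz g u v := by
  simp [J₁]

theorem J₂_horiz (u : TangentBundle 𝓘(ℝ, E) M) (v : TangentSpace 𝓘(ℝ, E) u.proj) :
    J₂ g J u (horiz g u v) = vert u (J u.proj v) := by
  simp [J₂]

theorem J₂_vert (u : TangentBundle 𝓘(ℝ, E) M) (v : TangentSpace 𝓘(ℝ, E) u.proj) :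
    J₂ g J u (vert u v) = horiz g u (J u.proj v) := by
  simp [J₂]

theorem sasaki_apply (u : TangentBundle 𝓘(ℝ, E) M) (ξ η : TangentSpace 𝓘(ℝ, E).tangent u) :
    sasaki g u ξ η = g u.proj (hPart u ξ) (hPart u η) + g u.proj (vPart g u ξ) (vPart g u η) :=
  rfl

end Lifts

end SasakiLift

end

/-! Each $F_\alpha(A,B,C)$ equals $\hat g(\hat\nabla_A(J_\alpha B),C)-\hat g(J_\alpha\hat\nabla_A
B,C)$. On lifts, $J_\alpha B$ is again plus or minus a lift (of $Y$ or $JY$). In the second term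
$J_\alpha$ moves onto $C$: $J_1$ is skew for $\hat g$, while $J_2$ and $J_3$ are self-adjoint
because $J$ is self-adjoint for $g$. So everything follows from the eight numbers $\hat
g(\hat\nabla_A B,C)$ with $A,B,C$ lifts of $X,Y,Z$.

These numbers come from the Koszul formula. The functions $\hat g(A,B)$ are pulled back from $M$.
The brackets are $[X^V,Y^V]=0$ and $[X^H,Y^V]=(\nabla_XY)^V$, while $[X^H,Y^H]$ projects to $[X,Y]$
and has vertical part $-R(X,Y)u$. The last is the only source of curvature. Skew-symmetry of $R$ in
its last two slots then brings $u$ to the end, and the first Bianchi identity is needed only for two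
components of $F_1$.

The computation is done in coordinates (`koszul`, `coordCurvature_skew`, `coordCurvature_bianchi`,
`sasaki_nabla_components`). Passing to manifolds takes care because the connection at each point is
defined through the chart centred at that point. Differentiating $\nabla_XY$, or the Sasaki metric,
compares charts at neighbouring points, and the transformation law `coordChristoffel_pullback` makes
this consistent (`chartField_nabla`, `vPart_coordChange`). `sasaki_nabla_lifts` is the resulting
table on $TM$. -/

noncomputable section

namespace SasakiLift

/-! ### Levi-Civita connection and curvature in coordinates -/

section Coordinates

/-- The regularity threshold for symmetry of second derivatives, used whenever Schwarz's theorem is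
invoked. -/
theorem two_le_infty : minSmoothness ℝ 2 ≤ (∞ : WithTop ℕ∞) := by
  rw [minSmoothness_of_isRCLikeNormedField]
  exact WithTop.coe_le_coe.2 (le_top : (2 : ℕ∞) ≤ ⊤)

variable {V : Type*} [NormedAddCommGroup V] [NormedSpace ℝ V]

/-- The Christoffel symbols of the first kind associated with the array `D a b c = ∂_a (g (b, c))`
of derivatives of the metric coefficients. -/
def firstKind (D : V →L[ℝ] V →L[ℝ] V →L[ℝ] ℝ) : V →L[ℝ] V →L[ℝ] V →L[ℝ] ℝ :=
  let D₂ : V →L[ℝ] V →L[ℝ] V →L[ℝ] ℝ := D.flip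
  let σ : (V →L[ℝ] V →L[ℝ] ℝ) →L[ℝ] (V →L[ℝ] V →L[ℝ] ℝ) :=
    (ContinuousLinearMap.flipₗᵢ ℝ V V ℝ).toContinuousLinearEquiv
  let D₃ : V →L[ℝ] V →L[ℝ] V →L[ℝ] ℝ := σ.comp D₂
  let S : V →L[ℝ] V →L[ℝ] V →L[ℝ] ℝ := D + D₂ - D₃
  (1 / 2 : ℝ) • S

theorem firstKind_apply (D : V →L[ℝ] V →L[ℝ] V →L[ℝ] ℝ) (a b c : V) :
    firstKind D a b c = (1 / 2 : ℝ) * (D a b c + D b a c - D c a b) := by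
  simp [firstKind]

/-- The Christoffel symbols of the second kind. -/
def secondKind (b : V →L[ℝ] V →L[ℝ] ℝ) (D : V →L[ℝ] V →L[ℝ] V →L[ℝ] ℝ) :
    V →L[ℝ] V →L[ℝ] V :=
  (ContinuousLinearMap.compL ℝ V (V →L[ℝ] ℝ) V b.inverse).comp (firstKind D)

/-- Nondegeneracy of a bilinear form. -/
def Nondeg (b : V →L[ℝ] V →L[ℝ] ℝ) : Prop := ∀ v, (∀ w, b v w = 0) → v = 0

theorem Nondeg.ext {b : V →L[ℝ] V →L[ℝ] ℝ} (hb : Nondeg b) {v w : V}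
    (h : ∀ c, b v c = b w c) : v = w :=
  sub_eq_zero.1 (hb _ fun c ↦ by simp [h c])

/-- In finite dimension an injective map to the dual is bijective. Hence `b.inverse` is a true
inverse here and not its default value. -/
theorem Nondeg.isInvertible [FiniteDimensional ℝ V] {b : V →L[ℝ] V →L[ℝ] ℝ} (hb : Nondeg b) :
    b.IsInvertible := by
  have hinj : Function.Injective (b : V →ₗ[ℝ] V →L[ℝ] ℝ) := by
    rw [← LinearMap.ker_eq_bot, LinearMap.ker_eq_bot']
    intro v hv
    exact hb v fun w ↦ by
      have : b v = 0 := hv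
      rw [this]; rfl
  have hfr : Module.finrank ℝ V = Module.finrank ℝ (V →L[ℝ] ℝ) := by
    rw [← (LinearMap.toContinuousLinearMap (𝕜 := ℝ) (E := V) (F' := ℝ)).finrank_eq]
    exact (Subspace.dual_finrank_eq (K := ℝ) (V := V)).symm
  refine ⟨(LinearEquiv.ofInjectiveOfFinrankEq _ hinj hfr).toContinuousLinearEquiv, ?_⟩
  ext v w
  rfl

/-- Lowering the raised index again. Together with nondegeneracy this characterises the symbols, so
the identities below can be tested against an arbitrary third vector. -/
theorem secondKind_apply [FiniteDimensional ℝ V] {b : V →L[ℝ] V →L[ℝ] ℝ} (hb : Nondeg b)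
    (D : V →L[ℝ] V →L[ℝ] V →L[ℝ] ℝ) (v w c : V) :
    b (secondKind b D v w) c = (1 / 2 : ℝ) * (D v w c + D w v c - D c v w) := by
  have h : b (b.inverse (firstKind D v w)) = firstKind D v w :=
    hb.isInvertible.self_apply_inverse _
  rw [← firstKind_apply, ← h]
  rfl

/-- The Christoffel symbols of a metric given in coordinates. -/
def coordChristoffel (G : V → V →L[ℝ] V →L[ℝ] ℝ) (x : V) : V →L[ℝ] V →L[ℝ] V :=
  secondKind (G x) (fderiv ℝ G x)

/-- The covariant derivative `∇_X Y` in coordinates. -/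
def coordNabla (G : V → V →L[ℝ] V →L[ℝ] ℝ) (X Y : V → V) (x : V) : V :=
  fderiv ℝ Y x (X x) + coordChristoffel G x (X x) (Y x)

/-- The Lie bracket in coordinates. -/
def coordBracket (X Y : V → V) (x : V) : V := fderiv ℝ Y x (X x) - fderiv ℝ X x (Y x)

/-- The curvature `R(a,b)c` in coordinates. -/
def coordCurvature (G : V → V →L[ℝ] V →L[ℝ] ℝ) (x a b c : V) : V :=
  fderiv ℝ (coordChristoffel G) x a b c - fderiv ℝ (coordChristoffel G) x b a c +
    coordChristoffel G x a (coordChristoffel G x b c) -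
    coordChristoffel G x b (coordChristoffel G x a c)

theorem differentiableAt_bilinearComp {W W' : Type*} [NormedAddCommGroup W] [NormedSpace ℝ W]
    [NormedAddCommGroup W'] [NormedSpace ℝ W']
    {B : W' → V →L[ℝ] V →L[ℝ] ℝ} {L : W' → W →L[ℝ] V} {x : W'}
    (hB : DifferentiableAt ℝ B x) (hL : DifferentiableAt ℝ L x) :
    DifferentiableAt ℝ (fun y ↦ (B y).bilinearComp (L y) (L y)) x := by
  unfold ContinuousLinearMap.bilinearComp
  have h2 : DifferentiableAt ℝ (fun y ↦ ((B y).comp (L y)).flip) x :=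
    ((ContinuousLinearMap.flipₗᵢ ℝ W V ℝ).differentiable _).comp x (hB.clm_comp hL)
  exact ((ContinuousLinearMap.flipₗᵢ ℝ W W ℝ).differentiable _).comp x (h2.clm_comp hL)

theorem fderiv_bilin_symm {G : V → V →L[ℝ] V →L[ℝ] ℝ} {x : V} (hG : DifferentiableAt ℝ G x)
    (hs : ∀ x a b, G x a b = G x b a) (a b c : V) : fderiv ℝ G x a b c = fderiv ℝ G x a c b := by
  have h (b c : V) : HasFDerivAt (fun y ↦ G y b c) _ x :=
    (hG.hasFDerivAt.clm_apply (hasFDerivAt_const b x)).clm_apply (hasFDerivAt_const c x)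
  have h1 := h b c
  simp_rw [fun y ↦ hs y b c] at h1
  have := congrArg (fun L : V →L[ℝ] ℝ ↦ L a) (h1.unique (h c b))
  simpa using this

theorem fderiv_bilin_apply {G : V → V →L[ℝ] V →L[ℝ] ℝ} {B C : V → V} {x : V}
    (hG : DifferentiableAt ℝ G x) (hB : DifferentiableAt ℝ B x) (hC : DifferentiableAt ℝ C x)
    (a : V) : fderiv ℝ (fun y ↦ G y (B y) (C y)) x a =
      fderiv ℝ G x a (B x) (C x) + G x (fderiv ℝ B x a) (C x) + G x (B x) (fderiv ℝ C x a) := by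
  have h := ((hG.hasFDerivAt.clm_apply hB.hasFDerivAt).clm_apply hC.hasFDerivAt).fderiv
  rw [h]
  simp
  ring

theorem fderiv_coordNabla {G : V → V →L[ℝ] V →L[ℝ] ℝ} {Y Z : V → V} {x : V}
    (hΓ : DifferentiableAt ℝ (coordChristoffel G) x)
    (hY : DifferentiableAt ℝ Y x) (hZ : ContDiffAt ℝ ∞ Z x) (a : V) :
    fderiv ℝ (coordNabla G Y Z) x a =
      fderiv ℝ (fderiv ℝ Z) x a (Y x) + fderiv ℝ Z x (fderiv ℝ Y x a) +
      (fderiv ℝ (coordChristoffel G) x a (Y x) (Z x) +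
        coordChristoffel G x (fderiv ℝ Y x a) (Z x) +
        coordChristoffel G x (Y x) (fderiv ℝ Z x a)) := by
  have hD : DifferentiableAt ℝ (fderiv ℝ Z) x :=
    (hZ.fderiv_right (m := ∞) le_rfl).differentiableAt (by simp)
  have hZ' : DifferentiableAt ℝ Z x := hZ.differentiableAt (by simp)
  have h := ((hD.hasFDerivAt.clm_apply hY.hasFDerivAt).add
    ((hΓ.hasFDerivAt.clm_apply hY.hasFDerivAt).clm_apply hZ'.hasFDerivAt)).fderiv
  change fderiv ℝ (coordNabla G Y Z) x = _ at h
  rw [h]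
  simp
  abel

theorem differentiableAt_coordNabla {G : V → V →L[ℝ] V →L[ℝ] ℝ} {Y Z : V → V} {x : V}
    (hΓ : DifferentiableAt ℝ (coordChristoffel G) x)
    (hY : DifferentiableAt ℝ Y x) (hZ : ContDiffAt ℝ ∞ Z x) :
    DifferentiableAt ℝ (coordNabla G Y Z) x := by
  have hD : DifferentiableAt ℝ (fderiv ℝ Z) x :=
    (hZ.fderiv_right (m := ∞) le_rfl).differentiableAt (by simp)
  have hZ' : DifferentiableAt ℝ Z x := hZ.differentiableAt (by simp)
  exact (hD.clm_apply hY).add ((hΓ.clm_apply hY).clm_apply hZ')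

/-- The curvature operator in terms of the Christoffel symbols. -/
theorem coordCurvature_eq {G : V → V →L[ℝ] V →L[ℝ] ℝ} {X Y Z : V → V} {x : V}
    (hΓ : DifferentiableAt ℝ (coordChristoffel G) x)
    (hX : DifferentiableAt ℝ X x) (hY : DifferentiableAt ℝ Y x) (hZ : ContDiffAt ℝ ∞ Z x) :
    coordNabla G X (coordNabla G Y Z) x - coordNabla G Y (coordNabla G X Z) x -
      (fderiv ℝ Z x (coordBracket X Y x) +
        coordChristoffel G x (coordBracket X Y x) (Z x)) =
      coordCurvature G x (X x) (Y x) (Z x) := by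
  have hsym : fderiv ℝ (fderiv ℝ Z) x (X x) (Y x) = fderiv ℝ (fderiv ℝ Z) x (Y x) (X x) :=
    (hZ.isSymmSndFDerivAt two_le_infty).eq _ _
  rw [coordNabla, fderiv_coordNabla hΓ hY hZ, coordNabla, coordNabla, fderiv_coordNabla hΓ hX hZ,
    coordNabla, hsym, coordBracket, coordCurvature]
  simp only [map_add, map_sub, sub_apply]
  abel

theorem coordCurvature_swap (G : V → V →L[ℝ] V →L[ℝ] ℝ) (x a b c : V) :
    coordCurvature G x a b c = -coordCurvature G x b a c := by
  simp only [coordCurvature]; abel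

variable [FiniteDimensional ℝ V]

theorem coordChristoffel_symm {G : V → V →L[ℝ] V →L[ℝ] ℝ} {x : V} (hG : DifferentiableAt ℝ G x)
    (hs : ∀ x a b, G x a b = G x b a) (hn : Nondeg (G x)) (a b : V) :
    coordChristoffel G x a b = coordChristoffel G x b a := by
  refine hn.ext fun c ↦ ?_
  simp only [coordChristoffel, secondKind_apply hn]
  rw [fderiv_bilin_symm hG hs c a b]; ring

/-- The pointwise form of $\nabla g=0$: in the sum of the two first-kind symbols the terms other
than $\partial_a g(b,c)$ cancel. -/
theorem fderiv_metric_apply {G : V → V →L[ℝ] V →L[ℝ] ℝ} {x : V} (hG : DifferentiableAt ℝ G x)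
    (hs : ∀ x a b, G x a b = G x b a) (hn : Nondeg (G x)) (a b c : V) :
    fderiv ℝ G x a b c =
      G x (coordChristoffel G x a b) c + G x b (coordChristoffel G x a c) := by
  rw [hs x b]
  simp only [coordChristoffel, secondKind_apply hn]
  rw [fderiv_bilin_symm hG hs a c b, fderiv_bilin_symm hG hs b a c,
    fderiv_bilin_symm hG hs c a b]; ring

/-- Metric compatibility. -/
theorem fderiv_metric_fields {G : V → V →L[ℝ] V →L[ℝ] ℝ} {A B C : V → V} {x : V}
    (hG : DifferentiableAt ℝ G x) (hs : ∀ x a b, G x a b = G x b a) (hn : Nondeg (G x))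
    (hB : DifferentiableAt ℝ B x) (hC : DifferentiableAt ℝ C x) :
    fderiv ℝ (fun y ↦ G y (B y) (C y)) x (A x) =
      G x (coordNabla G A B x) (C x) + G x (B x) (coordNabla G A C x) := by
  rw [fderiv_bilin_apply hG hB hC, fderiv_metric_apply hG hs hn, coordNabla, coordNabla]
  simp only [map_add, add_apply]
  ring

theorem coordNabla_sub_coordNabla {G : V → V →L[ℝ] V →L[ℝ] ℝ} {A B : V → V} {x : V}
    (hG : DifferentiableAt ℝ G x) (hs : ∀ x a b, G x a b = G x b a) (hn : Nondeg (G x)) :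
    coordNabla G A B x - coordNabla G B A x = coordBracket A B x := by
  rw [coordNabla, coordNabla, coordBracket, coordChristoffel_symm hG hs hn (A x)]
  abel

/-- The Koszul formula. -/
theorem koszul {G : V → V →L[ℝ] V →L[ℝ] ℝ} {A B C : V → V} {x : V}
    (hG : DifferentiableAt ℝ G x) (hs : ∀ x a b, G x a b = G x b a) (hn : Nondeg (G x))
    (hA : DifferentiableAt ℝ A x) (hB : DifferentiableAt ℝ B x) (hC : DifferentiableAt ℝ C x) :
    2 * G x (coordNabla G A B x) (C x) =
      fderiv ℝ (fun y ↦ G y (B y) (C y)) x (A x) + fderiv ℝ (fun y ↦ G y (A y) (C y)) x (B x) -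
      fderiv ℝ (fun y ↦ G y (A y) (B y)) x (C x) + G x (coordBracket A B x) (C x) -
      G x (coordBracket A C x) (B x) - G x (coordBracket B C x) (A x) := by
  rw [fderiv_metric_fields hG hs hn hB hC, fderiv_metric_fields hG hs hn hA hC,
    fderiv_metric_fields hG hs hn hA hB, ← coordNabla_sub_coordNabla hG hs hn,
    ← coordNabla_sub_coordNabla hG hs hn, ← coordNabla_sub_coordNabla hG hs hn]
  simp only [map_sub, sub_apply]
  rw [hs x (B x), hs x (A x), hs x (A x)]
  ring

/-- Inversion is smooth at an invertible operator, and the rest is linear in the metric and its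
first derivatives. -/
theorem contDiffAt_coordChristoffel {G : V → V →L[ℝ] V →L[ℝ] ℝ} {x : V}
    (hG : ContDiffAt ℝ ∞ G x) (hn : Nondeg (G x)) : ContDiffAt ℝ ∞ (coordChristoffel G) x := by
  have hD : ContDiffAt ℝ ∞ (fderiv ℝ G) x := hG.fderiv_right (m := ∞) le_rfl
  have hF : ContDiffAt ℝ ∞ (fun y ↦ firstKind (fderiv ℝ G y)) x := by
    unfold firstKind
    have h2 : ContDiffAt ℝ ∞ (fun y ↦ (fderiv ℝ G y).flip) x :=
      (ContinuousLinearMap.flipₗᵢ ℝ V V (V →L[ℝ] ℝ)).contDiff.contDiffAt.comp x hD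
    exact ((hD.add h2).sub (contDiffAt_const.clm_comp h2)).const_smul _
  have hI : ContDiffAt ℝ ∞ (fun y ↦ (G y).inverse) x := by
    obtain ⟨e, he⟩ := hn.isInvertible
    have := contDiffAt_map_inverse (𝕜 := ℝ) (n := ∞) e
    rw [he] at this
    exact this.comp x hG
  have hC : ContDiffAt ℝ ∞
      (fun y ↦ ContinuousLinearMap.compL ℝ V (V →L[ℝ] ℝ) V (G y).inverse) x :=
    (ContinuousLinearMap.compL ℝ V (V →L[ℝ] ℝ) V).contDiff.contDiffAt.comp x hI
  exact hC.clm_comp hF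

/-- `G` is a smooth pseudo-Riemannian metric in coordinates near `x`. -/
structure IsMetricAt (G : V → V →L[ℝ] V →L[ℝ] ℝ) (x : V) : Prop where
  smooth : ContDiffAt ℝ ∞ G x
  symm : ∀ x a b, G x a b = G x b a
  nondeg : ∀ᶠ y in 𝓝 x, Nondeg (G y)

namespace IsMetricAt

variable {G : V → V →L[ℝ] V →L[ℝ] ℝ} {x : V}

omit [FiniteDimensional ℝ V] in
theorem differentiableAt (h : IsMetricAt G x) : DifferentiableAt ℝ G x :=
  h.smooth.differentiableAt (by simp)

omit [FiniteDimensional ℝ V] in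
theorem eventually_differentiableAt (h : IsMetricAt G x) : ∀ᶠ y in 𝓝 x, DifferentiableAt ℝ G y :=
  ((h.smooth.of_le (by simp : (1 : WithTop ℕ∞) ≤ ∞)).eventually (by simp)).mono
    fun _ hy ↦ hy.differentiableAt (by simp)

theorem differentiableAt_christoffel (h : IsMetricAt G x) :
    DifferentiableAt ℝ (coordChristoffel G) x :=
  (contDiffAt_coordChristoffel h.smooth h.nondeg.self_of_nhds).differentiableAt (by simp)

theorem christoffel_symm (h : IsMetricAt G x) (a b : V) :
    coordChristoffel G x a b = coordChristoffel G x b a :=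
  coordChristoffel_symm h.differentiableAt h.symm h.nondeg.self_of_nhds a b

/-- Symmetry of $\Gamma$ holds throughout a neighbourhood, so it may be differentiated. -/
theorem fderiv_christoffel_symm (h : IsMetricAt G x) (a b c : V) :
    fderiv ℝ (coordChristoffel G) x a b c = fderiv ℝ (coordChristoffel G) x a c b := by
  have hΓb (b c : V) : HasFDerivAt (fun y ↦ coordChristoffel G y b c) _ x :=
    (h.differentiableAt_christoffel.hasFDerivAt.clm_apply (hasFDerivAt_const b x)).clm_apply
      (hasFDerivAt_const c x)
  have h12 : (fun y ↦ coordChristoffel G y b c) =ᶠ[𝓝 x] (fun y ↦ coordChristoffel G y c b) := by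
    filter_upwards [h.eventually_differentiableAt, h.nondeg] with y hy hny
    exact coordChristoffel_symm hy h.symm hny b c
  have := congrArg (fun L : V →L[ℝ] V ↦ L a)
    ((hΓb b c).unique ((hΓb c b).congr_of_eventuallyEq h12))
  simpa using this

end IsMetricAt

/-- Differentiating $\partial_b g(c,d)=g(\Gamma_bc,d)+g(c,\Gamma_bd)$ along $a$ and antisymmetrising
in $a,b$ kills the left side by Schwarz. Expanding the remaining $\partial g$ by compatibility
leaves $g(R(a,b)c,d)+g(c,R(a,b)d)=0$. -/
theorem coordCurvature_skew {G : V → V →L[ℝ] V →L[ℝ] ℝ} {x : V}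
    (h : IsMetricAt G x) (a b c d : V) :
    G x (coordCurvature G x a b c) d = -G x (coordCurvature G x a b d) c := by
  have hG := h.smooth
  have hs := h.symm
  have hn := h.nondeg
  have hG1 : DifferentiableAt ℝ G x := h.differentiableAt
  have hnx := hn.self_of_nhds
  have hΓ := h.differentiableAt_christoffel
  have hD : DifferentiableAt ℝ (fderiv ℝ G) x :=
    (hG.fderiv_right (m := ∞) le_rfl).differentiableAt (by simp)
  have key (a b : V) : fderiv ℝ (fderiv ℝ G) x a b c d =
      fderiv ℝ G x a (coordChristoffel G x b c) d + G x (fderiv ℝ (coordChristoffel G) x a b c) d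
      + (fderiv ℝ G x a c (coordChristoffel G x b d) +
        G x c (fderiv ℝ (coordChristoffel G) x a b d)) := by
    have h1 : HasFDerivAt (fun y ↦ fderiv ℝ G y b c d) _ x :=
      ((hD.hasFDerivAt.clm_apply (hasFDerivAt_const b x)).clm_apply
        (hasFDerivAt_const c x)).clm_apply (hasFDerivAt_const d x)
    have hΓb (c : V) : HasFDerivAt (fun y ↦ coordChristoffel G y b c) _ x :=
      (hΓ.hasFDerivAt.clm_apply (hasFDerivAt_const b x)).clm_apply (hasFDerivAt_const c x)
    have h2 : HasFDerivAt (fun y ↦ G y (coordChristoffel G y b c) d +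
        G y c (coordChristoffel G y b d)) _ x :=
      ((hG1.hasFDerivAt.clm_apply (hΓb c)).clm_apply (hasFDerivAt_const d x)).add
      ((hG1.hasFDerivAt.clm_apply (hasFDerivAt_const c x)).clm_apply (hΓb d))
    have h12 : (fun y ↦ fderiv ℝ G y b c d) =ᶠ[𝓝 x] (fun y ↦ G y (coordChristoffel G y b c) d +
        G y c (coordChristoffel G y b d)) := by
      filter_upwards [h.eventually_differentiableAt, hn] with y hy hny
      exact fderiv_metric_apply hy hs hny b c d
    have := congrArg (fun L : V →L[ℝ] ℝ ↦ L a) (h1.unique (h2.congr_of_eventuallyEq h12))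
    simp at this
    linarith
  have hsym : fderiv ℝ (fderiv ℝ G) x a b = fderiv ℝ (fderiv ℝ G) x b a :=
    (hG.isSymmSndFDerivAt two_le_infty).eq _ _
  have h := key a b
  rw [hsym, key b a] at h
  simp only [fderiv_metric_apply hG1 hs hnx] at h
  simp only [coordCurvature, map_add, map_sub, add_apply,
    sub_apply]
  simp only [hs x c] at h
  linarith

/-- With $\Gamma$ and its derivative symmetric in the lower slots, the cyclic sum cancels in pairs.
-/
theorem coordCurvature_bianchi {G : V → V →L[ℝ] V →L[ℝ] ℝ} {x : V} (h : IsMetricAt G x)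
    (a b c : V) :
    coordCurvature G x a b c + coordCurvature G x b c a + coordCurvature G x c a b = 0 := by
  simp only [coordCurvature]
  rw [h.fderiv_christoffel_symm a c b, h.fderiv_christoffel_symm b c a,
    h.fderiv_christoffel_symm c b a, h.christoffel_symm c b, h.christoffel_symm b a,
    h.christoffel_symm c a]
  abel

/-- Transformation law of the Christoffel symbols under a change of coordinates. -/
theorem coordChristoffel_pullback {G G' : V → V →L[ℝ] V →L[ℝ] ℝ} {φ : V → V} {x : V}
    (hφ : ContDiffAt ℝ ∞ φ x) (hφi : Function.Surjective (fderiv ℝ φ x))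
    (hG : DifferentiableAt ℝ G (φ x)) (hs : ∀ x a b, G x a b = G x b a) (hn : Nondeg (G (φ x)))
    (hn' : Nondeg (G' x))
    (hG' : ∀ᶠ y in 𝓝 x, ∀ a b, G' y a b = G (φ y) (fderiv ℝ φ y a) (fderiv ℝ φ y b)) (a b : V) :
    coordChristoffel G (φ x) (fderiv ℝ φ x a) (fderiv ℝ φ x b) + fderiv ℝ (fderiv ℝ φ) x a b =
      fderiv ℝ φ x (coordChristoffel G' x a b) := by
  have hφ1 : DifferentiableAt ℝ φ x := hφ.differentiableAt (by simp)
  have hDφ : DifferentiableAt ℝ (fderiv ℝ φ) x :=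
    (hφ.fderiv_right (m := ∞) le_rfl).differentiableAt (by simp)
  have hsym (a b : V) : fderiv ℝ (fderiv ℝ φ) x a b = fderiv ℝ (fderiv ℝ φ) x b a :=
    (hφ.isSymmSndFDerivAt two_le_infty).eq _ _
  have hGφ : HasFDerivAt (fun y ↦ G (φ y)) _ x := hG.hasFDerivAt.comp x hφ1.hasFDerivAt
  -- Differentiability of `G'` is inherited from the pullback formula, which holds near `x`.
  have hG'd : DifferentiableAt ℝ G' x := by
    have h : DifferentiableAt ℝ
        (fun y ↦ (G (φ y)).bilinearComp (fderiv ℝ φ y) (fderiv ℝ φ y)) x :=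
      differentiableAt_bilinearComp hGφ.differentiableAt hDφ
    refine h.congr_of_eventuallyEq (hG'.mono fun y hy ↦ ?_)
    ext a b
    exact hy a b
  have key (a b c : V) : fderiv ℝ G' x a b c =
      fderiv ℝ G (φ x) (fderiv ℝ φ x a) (fderiv ℝ φ x b) (fderiv ℝ φ x c) +
        G (φ x) (fderiv ℝ (fderiv ℝ φ) x a b) (fderiv ℝ φ x c) +
        G (φ x) (fderiv ℝ φ x b) (fderiv ℝ (fderiv ℝ φ) x a c) := by
    have h1 : HasFDerivAt (fun y ↦ G' y b c) _ x :=
      (hG'd.hasFDerivAt.clm_apply (hasFDerivAt_const b x)).clm_apply (hasFDerivAt_const c x)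
    have hD (b : V) : HasFDerivAt (fun y ↦ fderiv ℝ φ y b) _ x :=
      hDφ.hasFDerivAt.clm_apply (hasFDerivAt_const b x)
    have h2 : HasFDerivAt (fun y ↦ G (φ y) (fderiv ℝ φ y b) (fderiv ℝ φ y c)) _ x :=
      (hGφ.clm_apply (hD b)).clm_apply (hD c)
    have h12 : (fun y ↦ G' y b c) =ᶠ[𝓝 x]
        (fun y ↦ G (φ y) (fderiv ℝ φ y b) (fderiv ℝ φ y c)) := hG'.mono fun y hy ↦ hy b c
    have := congrArg (fun L : V →L[ℝ] ℝ ↦ L a) (h1.unique (h2.congr_of_eventuallyEq h12))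
    simp at this
    linarith
  -- It suffices to test against vectors $D\varphi(c)$, since $D\varphi$ is onto. In the first-kind
  -- combination of `key` the second derivatives of $\varphi$ cancel except for
  -- $g(D^2\varphi(a,b),D\varphi(c))$.
  refine hn.ext fun c ↦ ?_
  obtain ⟨c, rfl⟩ := hφi c
  rw [← hG'.self_of_nhds]
  simp only [coordChristoffel, secondKind_apply hn, secondKind_apply hn', map_add, add_apply, key]
  rw [hsym b a, hsym c a, hsym c b, hs _ (fderiv ℝ φ x b) (fderiv ℝ (fderiv ℝ φ) x a c)]
  ring

end Coordinates

/-! ### The Sasaki metric and lifts in induced coordinates -/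

section CoordinateSasaki

variable {V : Type*} [NormedAddCommGroup V] [NormedSpace ℝ V]

/-- The connection map in the induced coordinates of the tangent bundle. -/
def coordConn (G : V → V →L[ℝ] V →L[ℝ] ℝ) (z : V × V) : V × V →L[ℝ] V :=
  ContinuousLinearMap.snd ℝ V V + (coordChristoffel G z.1 z.2).comp (ContinuousLinearMap.fst ℝ V V)

/-- The Sasaki metric in the induced coordinates of the tangent bundle. -/
def coordSasaki (G : V → V →L[ℝ] V →L[ℝ] ℝ) (z : V × V) : V × V →L[ℝ] V × V →L[ℝ] ℝ :=
  (G z.1).bilinearComp (ContinuousLinearMap.fst ℝ V V) (ContinuousLinearMap.fst ℝ V V) +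
    (G z.1).bilinearComp (coordConn G z) (coordConn G z)

/-- The horizontal lift in induced coordinates. -/
def coordHoriz (G : V → V →L[ℝ] V →L[ℝ] ℝ) (X : V → V) (z : V × V) : V × V :=
  (X z.1, -coordChristoffel G z.1 z.2 (X z.1))

/-- The vertical lift in induced coordinates. -/
def coordVert (X : V → V) (z : V × V) : V × V := (0, X z.1)

variable {G : V → V →L[ℝ] V →L[ℝ] ℝ} {X Y Z : V → V} {z : V × V}

theorem coordConn_apply (a : V × V) : coordConn G z a = a.2 + coordChristoffel G z.1 z.2 a.1 := rfl

theorem coordSasaki_apply (a b : V × V) : coordSasaki G z a b =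
    G z.1 a.1 b.1 + G z.1 (coordConn G z a) (coordConn G z b) := rfl

@[simp] theorem coordConn_horiz : coordConn G z (coordHoriz G X z) = 0 := by
  simp [coordConn_apply, coordHoriz]

@[simp] theorem coordConn_vert : coordConn G z (coordVert X z) = X z.1 := by
  simp [coordConn_apply, coordVert]

@[simp] theorem coordHoriz_fst : (coordHoriz G X z).1 = X z.1 := rfl

omit [NormedSpace ℝ V] in
@[simp] theorem coordVert_fst : (coordVert X z).1 = 0 := rfl

@[simp] theorem coordSasaki_horiz (a : V × V) :
    coordSasaki G z a (coordHoriz G X z) = G z.1 a.1 (X z.1) := by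
  simp [coordSasaki_apply]

@[simp] theorem coordSasaki_vert (a : V × V) :
    coordSasaki G z a (coordVert X z) = G z.1 (coordConn G z a) (X z.1) := by
  simp [coordSasaki_apply]

theorem coordSasaki_symm (hs : ∀ x a b, G x a b = G x b a) (a b : V × V) :
    coordSasaki G z a b = coordSasaki G z b a := by
  rw [coordSasaki_apply, coordSasaki_apply, hs, hs _ (coordConn G z a)]

/-- Pairing with horizontal lifts detects the base component, and pairing with vertical lifts
detects the connection component. -/
theorem coordSasaki_nondeg (hn : Nondeg (G z.1)) : Nondeg (coordSasaki G z) := by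
  intro a ha
  have h1 : a.1 = 0 := hn _ fun w ↦ by
    simpa [coordSasaki_apply] using ha (coordHoriz G (fun _ ↦ w) z)
  have h2 : coordConn G z a = 0 := hn _ fun w ↦ by
    simpa [coordSasaki_apply] using ha (coordVert (fun _ ↦ w) z)
  rw [coordConn_apply, h1, map_zero, add_zero] at h2
  exact Prod.ext h1 h2

/-- First-order regularity is all that `koszul` asks of the metric on the total space. -/
theorem differentiableAt_coordSasaki (hG : DifferentiableAt ℝ G z.1)
    (hΓ : DifferentiableAt ℝ (coordChristoffel G) z.1) :
    DifferentiableAt ℝ (coordSasaki G) z := by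
  have hG' : DifferentiableAt ℝ (fun w : V × V ↦ G w.1) z := hG.comp z differentiableAt_fst
  have hΓ' : DifferentiableAt ℝ (fun w : V × V ↦ coordChristoffel G w.1) z :=
    hΓ.comp z differentiableAt_fst
  have hK : DifferentiableAt ℝ (coordConn G) z :=
    (differentiableAt_const _).add
      ((hΓ'.clm_apply differentiableAt_snd).clm_comp (differentiableAt_const _))
  exact (differentiableAt_bilinearComp hG' (differentiableAt_const _)).add
    (differentiableAt_bilinearComp hG' hK)

theorem hasFDerivAt_coordVert (hX : DifferentiableAt ℝ X z.1) :
    HasFDerivAt (coordVert X) ((0 : V × V →L[ℝ] V).prod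
      ((fderiv ℝ X z.1).comp (ContinuousLinearMap.fst ℝ V V))) z :=
  (hasFDerivAt_const 0 z).prodMk (hX.hasFDerivAt.comp z hasFDerivAt_fst)

theorem differentiableAt_coordHoriz (hΓ : DifferentiableAt ℝ (coordChristoffel G) z.1)
    (hX : DifferentiableAt ℝ X z.1) : DifferentiableAt ℝ (coordHoriz G X) z := by
  have hX' : DifferentiableAt ℝ (fun w : V × V ↦ X w.1) z := hX.comp z differentiableAt_fst
  have hΓ' : DifferentiableAt ℝ (fun w : V × V ↦ coordChristoffel G w.1) z :=
    hΓ.comp z differentiableAt_fst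
  exact hX'.prodMk ((hΓ'.clm_apply differentiableAt_snd).clm_apply hX').neg

theorem fderiv_coordHoriz (hΓ : DifferentiableAt ℝ (coordChristoffel G) z.1)
    (hX : DifferentiableAt ℝ X z.1) (a : V × V) :
    fderiv ℝ (coordHoriz G X) z a = (fderiv ℝ X z.1 a.1,
      -(fderiv ℝ (coordChristoffel G) z.1 a.1 z.2 (X z.1) +
        coordChristoffel G z.1 a.2 (X z.1) + coordChristoffel G z.1 z.2 (fderiv ℝ X z.1 a.1))) := by
  have hX' : HasFDerivAt (fun w : V × V ↦ X w.1) _ z :=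
    hX.hasFDerivAt.comp z hasFDerivAt_fst
  have hΓ' : HasFDerivAt (fun w : V × V ↦ coordChristoffel G w.1) _ z :=
    hΓ.hasFDerivAt.comp z hasFDerivAt_fst
  have h : HasFDerivAt (coordHoriz G X) _ z :=
    hX'.prodMk ((hΓ'.clm_apply hasFDerivAt_snd).clm_apply hX').neg
  rw [h.fderiv]
  simp
  abel

theorem fderiv_coordVert (hX : DifferentiableAt ℝ X z.1) (a : V × V) :
    fderiv ℝ (coordVert X) z a = (0, fderiv ℝ X z.1 a.1) := by
  rw [(hasFDerivAt_coordVert hX).fderiv]; rfl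

theorem coordBracket_vert_vert (hX : DifferentiableAt ℝ X z.1) (hY : DifferentiableAt ℝ Y z.1) :
    coordBracket (coordVert X) (coordVert Y) z = 0 := by
  simp [coordBracket, fderiv_coordVert hX, fderiv_coordVert hY]

theorem coordBracket_swap {W : Type*} [NormedAddCommGroup W] [NormedSpace ℝ W] (A B : W → W)
    (x : W) : coordBracket A B x = -coordBracket B A x := by
  simp [coordBracket]

/-- Inner products of lifts of equal type are pulled back from the base: vertical vectors annihilate
them, and horizontal ones differentiate as on the base. -/
theorem fderiv_metric_comp_fst (h : DifferentiableAt ℝ G z.1) (hX : DifferentiableAt ℝ X z.1)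
    (hY : DifferentiableAt ℝ Y z.1) (a : V × V) :
    fderiv ℝ (fun w : V × V ↦ G w.1 (X w.1) (Y w.1)) z a =
      fderiv ℝ (fun x ↦ G x (X x) (Y x)) z.1 a.1 := by
  have h1 : HasFDerivAt (fun x ↦ G x (X x) (Y x)) _ z.1 :=
    ((h.clm_apply hX).clm_apply hY).hasFDerivAt
  have h2 : HasFDerivAt (fun w : V × V ↦ G w.1 (X w.1) (Y w.1)) _ z := h1.comp z hasFDerivAt_fst
  rw [h2.fderiv]; rfl

variable [FiniteDimensional ℝ V]

/-- The horizontal lift is linear in the fibre coordinate, so differentiating it along $Y^V$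
produces $-\Gamma(Y,X)$. Symmetry of $\Gamma$ completes this to $(\nabla_XY)^V$. -/
theorem coordBracket_horiz_vert (h : IsMetricAt G z.1) (hX : DifferentiableAt ℝ X z.1)
    (hY : DifferentiableAt ℝ Y z.1) :
    coordBracket (coordHoriz G X) (coordVert Y) z = (0, coordNabla G X Y z.1) := by
  rw [coordBracket, fderiv_coordVert hY, fderiv_coordHoriz h.differentiableAt_christoffel hX]
  simp [coordVert, coordNabla, h.christoffel_symm (Y z.1)]

/-- Curvature as the obstruction to integrability of the horizontal distribution. The connection map
cancels the derivatives of $X$ and $Y$, and symmetry of $\Gamma$ moves the fibre coordinate to the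
last slot. -/
theorem coordConn_bracket_horiz_horiz (h : IsMetricAt G z.1) (hX : DifferentiableAt ℝ X z.1)
    (hY : DifferentiableAt ℝ Y z.1) :
    coordConn G z (coordBracket (coordHoriz G X) (coordHoriz G Y) z) =
      -coordCurvature G z.1 (X z.1) (Y z.1) z.2 := by
  rw [coordBracket, fderiv_coordHoriz h.differentiableAt_christoffel hX,
    fderiv_coordHoriz h.differentiableAt_christoffel hY, coordConn_apply, coordCurvature,
    h.fderiv_christoffel_symm _ z.2, h.fderiv_christoffel_symm _ z.2]
  simp only [coordHoriz, map_neg, map_sub, neg_apply, Prod.fst_sub, Prod.snd_sub]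
  rw [h.christoffel_symm z.2 (X z.1), h.christoffel_symm z.2 (Y z.1),
    h.christoffel_symm (coordChristoffel G z.1 (X z.1) z.2),
    h.christoffel_symm (coordChristoffel G z.1 (Y z.1) z.2)]
  abel

theorem coordBracket_horiz_horiz_fst (h : IsMetricAt G z.1) (hX : DifferentiableAt ℝ X z.1)
    (hY : DifferentiableAt ℝ Y z.1) :
    (coordBracket (coordHoriz G X) (coordHoriz G Y) z).1 = coordBracket X Y z.1 := by
  rw [coordBracket, fderiv_coordHoriz h.differentiableAt_christoffel hX,
    fderiv_coordHoriz h.differentiableAt_christoffel hY]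
  rfl

/-- The components of the Levi-Civita connection of the Sasaki metric on lifts. -/
theorem sasaki_nabla_components (h : IsMetricAt G z.1) (hX : DifferentiableAt ℝ X z.1)
    (hY : DifferentiableAt ℝ Y z.1) (hZ : DifferentiableAt ℝ Z z.1) :
    let S (A B C : V × V → V × V) : ℝ := coordSasaki G z (coordNabla (coordSasaki G) A B z) (C z)
    let H := coordHoriz G
    let W (X : V → V) := coordVert X
    let R (a b c d : V) : ℝ := G z.1 (coordCurvature G z.1 a b c) d
    S (H X) (H Y) (H Z) = G z.1 (coordNabla G X Y z.1) (Z z.1) ∧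
    S (H X) (H Y) (W Z) = 1 / 2 * R (X z.1) (Y z.1) (Z z.1) z.2 ∧
    S (H X) (W Y) (H Z) = -(1 / 2) * R (X z.1) (Z z.1) (Y z.1) z.2 ∧
    S (H X) (W Y) (W Z) = G z.1 (coordNabla G X Y z.1) (Z z.1) ∧
    S (W X) (H Y) (H Z) = -(1 / 2) * R (Y z.1) (Z z.1) (X z.1) z.2 ∧
    S (W X) (H Y) (W Z) = 0 ∧
    S (W X) (W Y) (H Z) = 0 ∧
    S (W X) (W Y) (W Z) = 0 := by
  intro S H W R
  have hd := h.differentiableAt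
  have hn := h.nondeg.self_of_nhds
  have hH {X : V → V} (hX : DifferentiableAt ℝ X z.1) : DifferentiableAt ℝ (H X) z :=
    differentiableAt_coordHoriz h.differentiableAt_christoffel hX
  have hW {X : V → V} (hX : DifferentiableAt ℝ X z.1) : DifferentiableAt ℝ (W X) z :=
    (hasFDerivAt_coordVert hX).differentiableAt
  have kz {A B C : V × V → V × V} (hA : DifferentiableAt ℝ A z) (hB : DifferentiableAt ℝ B z)
      (hC : DifferentiableAt ℝ C z) :=
    koszul (differentiableAt_coordSasaki hd h.differentiableAt_christoffel)
      (fun _ a b ↦ coordSasaki_symm h.symm a b) (coordSasaki_nondeg hn) hA hB hC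
  have kG := koszul hd h.symm hn hX hY hZ
  -- Koszul produces $R(\cdot,\cdot)u$ paired with a field; skew-symmetry puts $u$ in the last slot.
  have sk (a b c d : V) : G z.1 (coordCurvature G z.1 a b c) d =
      -G z.1 (coordCurvature G z.1 a b d) c := coordCurvature_skew h a b c d
  have hs := h.symm z.1
  -- In the components with two vertical slots the derivative of $g$ along the horizontal field is
  -- split by metric compatibility, matching the terms from the mixed brackets.
  have mc {A B C : V → V} (hB : DifferentiableAt ℝ B z.1) (hC : DifferentiableAt ℝ C z.1) :
      fderiv ℝ (fun y ↦ G y (B y) (C y)) z.1 (A z.1) = _ := fderiv_metric_fields hd h.symm hn hB hC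
  have bHW {X Y : V → V} (hX : DifferentiableAt ℝ X z.1) (hY : DifferentiableAt ℝ Y z.1) :
      coordBracket (coordHoriz G X) (coordVert Y) z = (0, coordNabla G X Y z.1) :=
    coordBracket_horiz_vert h hX hY
  have bWH {X Y : V → V} (hX : DifferentiableAt ℝ X z.1) (hY : DifferentiableAt ℝ Y z.1) :
      coordBracket (coordVert X) (coordHoriz G Y) z = -(0, coordNabla G Y X z.1) := by
    rw [coordBracket_swap, bHW hY hX]
  have cW (a : V) : coordConn G z (0, a) = a := by simp [coordConn_apply]
  refine ⟨?_, ?_, ?_, ?_, ?_, ?_, ?_, ?_⟩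
  · have e := kz (hH hX) (hH hY) (hH hZ)
    simp [H, fderiv_metric_comp_fst hd, hX, hY, hZ,
      coordBracket_horiz_horiz_fst h] at e
    simp only [S, H, coordSasaki_horiz]
    linarith
  · have e := kz (hH hX) (hH hY) (hW hZ)
    simp [H, W, fderiv_metric_comp_fst hd, hX, hY, hZ, bHW,
      coordConn_bracket_horiz_horiz h] at e
    simp only [S, H, W, R, coordSasaki_vert]
    linarith [sk (X z.1) (Y z.1) z.2 (Z z.1)]
  · have e := kz (hH hX) (hW hY) (hH hZ)
    simp [H, W, fderiv_metric_comp_fst hd, hX, hY, hZ, bHW, bWH, coordConn_bracket_horiz_horiz h] at e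
    simp only [S, H, W, R, coordSasaki_horiz]
    linarith [sk (X z.1) (Z z.1) z.2 (Y z.1)]
  · have e := kz (hH hX) (hW hY) (hW hZ)
    simp [H, W, fderiv_metric_comp_fst hd, hX, hY, hZ, bHW, cW, coordBracket_vert_vert] at e
    simp only [S, H, W, coordSasaki_vert]
    linarith [mc (A := X) hY hZ, hs (Y z.1) (coordNabla G X Z z.1)]
  · have e := kz (hW hX) (hH hY) (hH hZ)
    simp [H, W, fderiv_metric_comp_fst hd, hX, hY, hZ, bWH, coordConn_bracket_horiz_horiz h] at e
    simp only [S, H, W, R, coordSasaki_horiz]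
    linarith [sk (Y z.1) (Z z.1) z.2 (X z.1)]
  · have e := kz (hW hX) (hH hY) (hW hZ)
    simp [H, W, fderiv_metric_comp_fst hd, hX, hY, hZ, bHW, bWH, cW, coordBracket_vert_vert] at e
    simp only [S, H, W, coordSasaki_vert]
    linarith [mc (A := Y) hX hZ, hs (X z.1) (coordNabla G Y Z z.1)]
  · have e := kz (hW hX) (hW hY) (hH hZ)
    simp [H, W, fderiv_metric_comp_fst hd, hX, hY, hZ, bWH, cW, coordBracket_vert_vert] at e
    simp only [S, H, W, coordSasaki_horiz]
    linarith [mc (A := Z) hX hY, hs (X z.1) (coordNabla G Z Y z.1)]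
  · have e := kz (hW hX) (hW hY) (hW hZ)
    simp [W, fderiv_metric_comp_fst hd, hX, hY, hZ, coordBracket_vert_vert] at e
    simp only [S, W, coordSasaki_vert]
    linarith

end CoordinateSasaki

/-! ### Coordinate invariance of the covariant derivative -/

section CoordinateChange

variable {V : Type*} [NormedAddCommGroup V] [NormedSpace ℝ V] [FiniteDimensional ℝ V]

/-- The coordinate formula for the covariant derivative does not depend on the coordinates. -/
theorem coordNabla_pullback {G G' : V → V →L[ℝ] V →L[ℝ] ℝ} {φ : V → V} {X X' Y Y' : V → V} {x : V}
    (hφ : ContDiffAt ℝ ∞ φ x) (hφi : Function.Surjective (fderiv ℝ φ x))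
    (hG : DifferentiableAt ℝ G (φ x)) (hs : ∀ x a b, G x a b = G x b a) (hn : Nondeg (G (φ x)))
    (hn' : Nondeg (G' x))
    (hG' : ∀ᶠ y in 𝓝 x, ∀ a b, G' y a b = G (φ y) (fderiv ℝ φ y a) (fderiv ℝ φ y b))
    (hX' : X (φ x) = fderiv ℝ φ x (X' x))
    (hY : DifferentiableAt ℝ Y (φ x)) (hY' : DifferentiableAt ℝ Y' x)
    (h : ∀ᶠ y in 𝓝 x, Y (φ y) = fderiv ℝ φ y (Y' y)) :
    coordNabla G X Y (φ x) = fderiv ℝ φ x (coordNabla G' X' Y' x) := by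
  have hφ1 : DifferentiableAt ℝ φ x := hφ.differentiableAt (by simp)
  have hDφ : DifferentiableAt ℝ (fderiv ℝ φ) x :=
    (hφ.fderiv_right (m := ∞) le_rfl).differentiableAt (by simp)
  have h1 : HasFDerivAt (fun y ↦ Y (φ y)) _ x := hY.hasFDerivAt.comp x hφ1.hasFDerivAt
  have h2 : HasFDerivAt (fun y ↦ fderiv ℝ φ y (Y' y)) _ x :=
    hDφ.hasFDerivAt.clm_apply hY'.hasFDerivAt
  have key := congrArg (fun L : V →L[ℝ] V ↦ L (X' x)) (h1.unique (h2.congr_of_eventuallyEq h))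
  simp at key
  rw [coordNabla, coordNabla, hX', key, h.self_of_nhds, map_add,
    ← coordChristoffel_pullback hφ hφi hG hs hn hn' hG']
  abel

end CoordinateChange

/-! ### Reading the intrinsic objects in charts -/

section Charts

variable {E : Type*} [NormedAddCommGroup E] [NormedSpace ℝ E]
  {H : Type*} [TopologicalSpace H] {I : ModelWithCorners ℝ E H} [I.Boundaryless]
  {N : Type*} [TopologicalSpace N] [ChartedSpace H N]

/-- Without boundary the model range is everything, so the derivative within it is the ordinary one.
Continuity on the manifold is recovered by composing back with the chart. -/
theorem mvfderiv_eq_fderiv {F : Type*} [NormedAddCommGroup F] [NormedSpace ℝ F] {f : N → F} {p : N}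
    (hf : DifferentiableAt ℝ (f ∘ (extChartAt I p).symm) (extChartAt I p p)) :
    (mvfderiv I f p : E →L[ℝ] F) =
      fderiv ℝ (f ∘ (extChartAt I p).symm) (extChartAt I p p) := by
  have hm : MDifferentiableAt I 𝓘(ℝ, F) f p := by
    rw [mdifferentiableAt_iff]
    refine ⟨?_, by rw [I.range_eq_univ, differentiableWithinAt_univ]; exact hf⟩
    have h := hf.continuousAt.comp (continuousAt_extChartAt (I := I) p)
    refine h.congr ?_
    filter_upwards [extChartAt_source_mem_nhds (I := I) p] with q hq
    exact congrArg f ((extChartAt I p).left_inv hq)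
  have h : mfderiv I 𝓘(ℝ, F) f p = _ := hm.mfderiv
  rw [writtenInExtChartAt, I.range_eq_univ, fderivWithin_univ] at h
  ext v
  change mfderiv I 𝓘(ℝ, F) f p v = _
  rw [h]
  rfl

variable [IsManifold I 1 N]

/-- The matrix of `g` in the chart at `p`, as a function of the coordinates. -/
def chartMetric (g : Π x : N, TangentSpace I x →L[ℝ] TangentSpace I x →L[ℝ] ℝ) (p : N) :
    E → E →L[ℝ] E →L[ℝ] ℝ := metricInChart g p ∘ (extChartAt I p).symm

/-- The components of a vector field in the chart at `p`, as a function of the coordinates. -/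
def chartField (Y : Π x : N, TangentSpace I x) (p : N) : E → E :=
  (fun q ↦ (trivializationAt E (TangentSpace I) p ⟨q, Y q⟩).2) ∘ (extChartAt I p).symm

omit [I.Boundaryless] in
theorem trivializationAt_snd (p q : N) (v : TangentSpace I q) :
    (trivializationAt E (TangentSpace I) p ⟨q, v⟩).2 = tangentCoordChange I q p q v := rfl

omit [I.Boundaryless] in
theorem symmL_eq {p q : N} (hq : q ∈ (extChartAt I p).source) (a : E) :
    ((trivializationAt E (TangentSpace I) p).symmL ℝ q a : E) = tangentCoordChange I p q q a := by
  rw [TangentBundle.symmL_trivializationAt_eq_core (by simpa using hq)]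
  rfl

omit [I.Boundaryless] in
theorem tangentCoordChange_inv {p q r : N} (hp : r ∈ (extChartAt I p).source)
    (hq : r ∈ (extChartAt I q).source) (v : E) :
    tangentCoordChange I p q r (tangentCoordChange I q p r v) = v := by
  rw [tangentCoordChange_comp ⟨⟨hq, hp⟩, hq⟩, tangentCoordChange_self hq]

/-- A field of bilinear forms on the tangent spaces, with values in the bilinear forms on the
model space. -/
def modelForm (g : Π x : N, TangentSpace I x →L[ℝ] TangentSpace I x →L[ℝ] ℝ) (q : N) :
    E →L[ℝ] E →L[ℝ] ℝ := g q

omit [I.Boundaryless] in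
theorem metricInChart_apply (g : Π x : N, TangentSpace I x →L[ℝ] TangentSpace I x →L[ℝ] ℝ)
    {p q : N} (hq : q ∈ (extChartAt I p).source) (a b : E) :
    metricInChart g p q a b =
      modelForm g q (tangentCoordChange I p q q a) (tangentCoordChange I p q q b) := by
  rw [← symmL_eq hq a, ← symmL_eq hq b]
  rfl

omit [I.Boundaryless] in
theorem chartMetric_apply (g : Π x : N, TangentSpace I x →L[ℝ] TangentSpace I x →L[ℝ] ℝ)
    {p : N} {x : E} (hx : x ∈ (extChartAt I p).target) (a b : E) :
    chartMetric g p x a b = modelForm g ((extChartAt I p).symm x)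
      (tangentCoordChange I p ((extChartAt I p).symm x) ((extChartAt I p).symm x) a)
      (tangentCoordChange I p ((extChartAt I p).symm x) ((extChartAt I p).symm x) b) :=
  metricInChart_apply g ((extChartAt I p).map_target hx) a b

omit [I.Boundaryless] in
theorem chartMetric_self (g : Π x : N, TangentSpace I x →L[ℝ] TangentSpace I x →L[ℝ] ℝ) (p : N) :
    chartMetric g p (extChartAt I p p) = modelForm g p := by
  ext a b
  have hp := mem_extChartAt_source (I := I) p
  rw [chartMetric, Function.comp_apply, extChartAt_to_inv, metricInChart_apply g hp,
    tangentCoordChange_self hp, tangentCoordChange_self hp]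

omit [I.Boundaryless] in
theorem chartField_self (Y : Π x : N, TangentSpace I x) (p : N) :
    chartField Y p (extChartAt I p p) = (Y p : E) := by
  rw [chartField, Function.comp_apply, extChartAt_to_inv, trivializationAt_snd]
  exact tangentCoordChange_self (mem_extChartAt_source (I := I) p)

/-- At the centre of its own chart the coordinate frame is the identity, so the two formulas agree
there. At other points of the chart the transformation law is needed. -/
theorem christoffel_eq_coordChristoffel
    {g : Π x : N, TangentSpace I x →L[ℝ] TangentSpace I x →L[ℝ] ℝ} {p : N}
    (hg : DifferentiableAt ℝ (chartMetric g p) (extChartAt I p p)) :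
    christoffel g p = coordChristoffel (chartMetric g p) (extChartAt I p p) := by
  rw [coordChristoffel, chartMetric_self]
  have h : metricDeriv g p = fderiv ℝ (chartMetric g p) (extChartAt I p p) :=
    mvfderiv_eq_fderiv hg
  rw [← h]
  rfl

theorem leviCivita_eq {g : Π x : N, TangentSpace I x →L[ℝ] TangentSpace I x →L[ℝ] ℝ} {p : N}
    (hg : DifferentiableAt ℝ (chartMetric g p) (extChartAt I p p))
    {Y : Π x : N, TangentSpace I x}
    (hY : DifferentiableAt ℝ (chartField Y p) (extChartAt I p p)) (v : E) :
    (leviCivita g Y p v : E) = fderiv ℝ (chartField Y p) (extChartAt I p p) v +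
      coordChristoffel (chartMetric g p) (extChartAt I p p) v
        (chartField Y p (extChartAt I p p)) := by
  rw [← christoffel_eq_coordChristoffel hg, chartField_self]
  have h := mvfderiv_eq_fderiv hY
  rw [chartField, ← h]
  rfl

theorem nabla_eq_coordNabla {g : Π x : N, TangentSpace I x →L[ℝ] TangentSpace I x →L[ℝ] ℝ} {p : N}
    (hg : DifferentiableAt ℝ (chartMetric g p) (extChartAt I p p))
    (X : Π x : N, TangentSpace I x) {Y : Π x : N, TangentSpace I x}
    (hY : DifferentiableAt ℝ (chartField Y p) (extChartAt I p p)) :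
    (nabla g X Y p : E) =
      coordNabla (chartMetric g p) (chartField X p) (chartField Y p) (extChartAt I p p) := by
  rw [coordNabla, chartField_self X]
  exact leviCivita_eq hg hY (X p)

/-- The transition map from the chart at `p` to the chart at `q`. -/
def transition (I : ModelWithCorners ℝ E H) {N : Type*} [TopologicalSpace N] [ChartedSpace H N]
    (p q : N) : E → E := extChartAt I q ∘ (extChartAt I p).symm

omit [IsManifold I 1 N] in
theorem eventually_mem_source {p q : N} (hq : q ∈ (extChartAt I p).source) :
    ∀ᶠ x in 𝓝 (extChartAt I p q), x ∈ (extChartAt I p).target ∧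
      (extChartAt I p).symm x ∈ (extChartAt I q).source := by
  have h1 : (extChartAt I p).target ∈ 𝓝 (extChartAt I p q) :=
    extChartAt_target_mem_nhds' ((extChartAt I p).map_source hq)
  refine Filter.Eventually.and h1 ?_
  have hc : ContinuousAt (extChartAt I p).symm (extChartAt I p q) :=
    continuousAt_extChartAt_symm' hq
  refine hc.eventually_mem ?_
  rw [(extChartAt I p).left_inv hq]
  exact extChartAt_source_mem_nhds q

theorem fderiv_transition (p q r : N) :
    fderiv ℝ (transition I p q) (extChartAt I p r) = tangentCoordChange I p q r := by
  rw [tangentCoordChange_def, I.range_eq_univ, fderivWithin_univ]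
  rfl

theorem fderiv_transition' {p q : N} {x : E} (hx : x ∈ (extChartAt I p).target) :
    fderiv ℝ (transition I p q) x = tangentCoordChange I p q ((extChartAt I p).symm x) := by
  rw [← fderiv_transition p q, (extChartAt I p).right_inv hx]

omit [I.Boundaryless] [IsManifold I 1 N] in
theorem transition_apply_self {p q : N} (hq : q ∈ (extChartAt I p).source) :
    transition I p q (extChartAt I p q) = extChartAt I q q := by
  rw [transition, Function.comp_apply, (extChartAt I p).left_inv hq]

theorem surjective_fderiv_transition {p q : N} (hq : q ∈ (extChartAt I p).source) :
    Function.Surjective (fderiv ℝ (transition I p q) (extChartAt I p q)) := by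
  intro a
  rw [fderiv_transition p q q]
  exact ⟨tangentCoordChange I q p q a, tangentCoordChange_inv hq (mem_extChartAt_source q) a⟩

/-- The cocycle identity for tangent coordinate changes. This supplies the pullback hypothesis of
the transformation laws. -/
theorem chartMetric_transition (g : Π x : N, TangentSpace I x →L[ℝ] TangentSpace I x →L[ℝ] ℝ)
    {p q : N} {x : E} (hx : x ∈ (extChartAt I p).target)
    (hx' : (extChartAt I p).symm x ∈ (extChartAt I q).source) (a b : E) :
    chartMetric g p x a b = chartMetric g q (transition I p q x)
      (fderiv ℝ (transition I p q) x a) (fderiv ℝ (transition I p q) x b) := by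
  have hs := (extChartAt I p).map_target hx
  have ht : (extChartAt I q).symm (transition I p q x) = (extChartAt I p).symm x :=
    (extChartAt I q).left_inv hx'
  have ht' : transition I p q x ∈ (extChartAt I q).target := (extChartAt I q).map_source hx'
  rw [chartMetric_apply g hx, chartMetric_apply g ht', ht, fderiv_transition' hx]
  have h3 := mem_extChartAt_source (I := I) ((extChartAt I p).symm x)
  rw [tangentCoordChange_comp ⟨⟨hs, hx'⟩, h3⟩, tangentCoordChange_comp ⟨⟨hs, hx'⟩, h3⟩]

theorem chartField_transition (Y : Π x : N, TangentSpace I x)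
    {p q : N} {x : E} (hx : x ∈ (extChartAt I p).target)
    (hx' : (extChartAt I p).symm x ∈ (extChartAt I q).source) :
    chartField Y q (transition I p q x) = fderiv ℝ (transition I p q) x (chartField Y p x) := by
  have hs := (extChartAt I p).map_target hx
  have ht : (extChartAt I q).symm (transition I p q x) = (extChartAt I p).symm x :=
    (extChartAt I q).left_inv hx'
  rw [chartField, Function.comp_apply, ht, trivializationAt_snd, fderiv_transition' hx, chartField,
    Function.comp_apply, trivializationAt_snd]
  have h3 := mem_extChartAt_source (I := I) ((extChartAt I p).symm x)
  exact (tangentCoordChange_comp ⟨⟨h3, hs⟩, hx'⟩).symm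

omit [IsManifold I 1 N] in
theorem contDiffAt_transition [IsManifold I ∞ N] {p q : N} (hq : q ∈ (extChartAt I p).source) :
    ContDiffAt ℝ ∞ (transition I p q) (extChartAt I p q) := by
  have h := contDiffWithinAt_ext_coord_change (I := I) (n := ∞) q p (y := extChartAt I p q) (by
    simp only [PartialEquiv.trans_source, PartialEquiv.symm_source, Set.mem_inter_iff,
      Set.mem_preimage]
    refine ⟨(extChartAt I p).map_source hq, ?_⟩
    rw [(extChartAt I p).left_inv hq]
    exact mem_extChartAt_source q)
  rw [I.range_eq_univ, contDiffWithinAt_univ] at h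
  exact h

end Charts

/-! ### Smoothness, covariant derivative, bracket and curvature on the base -/

section BaseCharts

variable {E : Type*} [NormedAddCommGroup E] [NormedSpace ℝ E]
  {M : Type*} [TopologicalSpace M] [ChartedSpace E M] [IsManifold 𝓘(ℝ, E) ∞ M]

theorem IsSmoothField.contDiffAt_chartField {X : Π x : M, TangentSpace 𝓘(ℝ, E) x}
    (hX : IsSmoothField X) (p : M) :
    ContDiffAt ℝ ∞ (chartField X p) (extChartAt 𝓘(ℝ, E) p p) := by
  have h1 := (Bundle.contMDiffAt_section p).1 (hX p)
  have h2 : ContMDiffAt 𝓘(ℝ, E) 𝓘(ℝ, E) ∞ (extChartAt 𝓘(ℝ, E) p).symm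
      (extChartAt 𝓘(ℝ, E) p p) :=
    (contMDiffOn_extChartAt_symm p).contMDiffAt (extChartAt_target_mem_nhds p)
  rw [← contMDiffAt_iff_contDiffAt]
  refine ContMDiffAt.comp _ ?_ h2
  rw [extChartAt_to_inv]
  exact h1

theorem AlmostSkewHermitian.isSmoothField_act (S : AlmostSkewHermitian E M)
    {X : Π x : M, TangentSpace 𝓘(ℝ, E) x} (hX : IsSmoothField X) : IsSmoothField (act S.J X) :=
  ContMDiff.clm_bundle_apply S.smooth_J hX

theorem chartMetric_symm (S : AlmostSkewHermitian E M) (p : M) (x a b : E) :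
    chartMetric S.g p x a b = chartMetric S.g p x b a := by
  let e : E →L[ℝ] E := (trivializationAt E (TangentSpace 𝓘(ℝ, E)) p).symmL ℝ
    ((extChartAt 𝓘(ℝ, E) p).symm x)
  exact S.symm ((extChartAt 𝓘(ℝ, E) p).symm x) (e a) (e b)

/-- Smoothness of a section of a hom bundle is smoothness of its coordinate expression, which
coincides with `metricInChart` on the chart domain. -/
theorem contDiffAt_chartMetric (S : AlmostSkewHermitian E M) (p : M) :
    ContDiffAt ℝ ∞ (chartMetric S.g p) (extChartAt 𝓘(ℝ, E) p p) := by
  have h1 := ((contMDiffAt_hom_bundle _).1 (S.smooth_g p)).2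
  have h2 : ContMDiffAt 𝓘(ℝ, E) 𝓘(ℝ, E) ∞ (extChartAt 𝓘(ℝ, E) p).symm
      (extChartAt 𝓘(ℝ, E) p p) :=
    (contMDiffOn_extChartAt_symm p).contMDiffAt (extChartAt_target_mem_nhds p)
  rw [← contMDiffAt_iff_contDiffAt]
  refine ContMDiffAt.comp _ ?_ h2
  rw [extChartAt_to_inv]
  refine h1.congr_of_eventuallyEq ?_
  filter_upwards [extChartAt_source_mem_nhds (I := 𝓘(ℝ, E)) p] with q hq
  have hq' : q ∈ (trivializationAt E (TangentSpace 𝓘(ℝ, E)) p).baseSet := by simpa using hq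
  ext a b
  have := inCoordinates_apply_eq₂ (𝕜 := ℝ) (F₁ := E) (F₂ := E) (F₃ := ℝ)
    (E₃ := fun _ : M ↦ ℝ) (ϕ := S.g q) (v := a) (w := b) hq' hq' (Set.mem_univ q)
  refine Eq.trans ?_ this.symm
  simp only [metricInChart, Bundle.Trivial.linearMapAt_trivialization, LinearMap.id_apply,
    Bundle.Trivial.fiberBundle_trivializationAt']
  exact congrArg₂ (fun v w : E ↦ modelForm S.g q v w)
    ((trivializationAt E (TangentSpace 𝓘(ℝ, E)) p).symmL_apply (R := ℝ) hq' a)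
    ((trivializationAt E (TangentSpace 𝓘(ℝ, E)) p).symmL_apply (R := ℝ) hq' b)

theorem chartMetric_nondeg (S : AlmostSkewHermitian E M) (p : M) {x : E}
    (hx : x ∈ (extChartAt 𝓘(ℝ, E) p).target) : Nondeg (chartMetric S.g p x) := by
  intro a ha
  set q := (extChartAt 𝓘(ℝ, E) p).symm x with hq
  have hs := (extChartAt 𝓘(ℝ, E) p).map_target hx
  have hi := mem_extChartAt_source (I := 𝓘(ℝ, E)) q
  have h0 : tangentCoordChange 𝓘(ℝ, E) p q q a = 0 := by
    refine S.nondegenerate q _ fun (w : E) ↦ ?_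
    have := ha (tangentCoordChange 𝓘(ℝ, E) q p q w)
    rw [chartMetric_apply _ hx, ← hq, tangentCoordChange_inv hs hi] at this
    exact this
  rw [← tangentCoordChange_inv hi hs a, h0, map_zero]

theorem isMetricAt_chartMetric (S : AlmostSkewHermitian E M) (p : M) :
    IsMetricAt (chartMetric S.g p) (extChartAt 𝓘(ℝ, E) p p) where
  smooth := contDiffAt_chartMetric S p
  symm := chartMetric_symm S p
  nondeg := Filter.eventually_of_mem (extChartAt_target_mem_nhds p) fun _ ↦ chartMetric_nondeg S p

variable [FiniteDimensional ℝ E] (S : AlmostSkewHermitian E M)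

/-- Transformation law of the Christoffel symbols between charts. -/
theorem christoffel_transition {p q : M} (hq : q ∈ (extChartAt 𝓘(ℝ, E) p).source) (a b : E) :
    (christoffel S.g q (tangentCoordChange 𝓘(ℝ, E) p q q a : E)
        (tangentCoordChange 𝓘(ℝ, E) p q q b) : E) +
      fderiv ℝ (fderiv ℝ (transition 𝓘(ℝ, E) p q)) (extChartAt 𝓘(ℝ, E) p q) a b =
      tangentCoordChange 𝓘(ℝ, E) p q q
        (coordChristoffel (chartMetric S.g p) (extChartAt 𝓘(ℝ, E) p q) a b) := by
  have h := isMetricAt_chartMetric S q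
  rw [christoffel_eq_coordChristoffel h.differentiableAt, ← fderiv_transition,
    ← transition_apply_self hq]
  refine coordChristoffel_pullback (contDiffAt_transition hq) (surjective_fderiv_transition hq)
    ?_ h.symm ?_ (chartMetric_nondeg S p ((extChartAt 𝓘(ℝ, E) p).map_source hq)) ?_ a b
  · rw [transition_apply_self hq]; exact h.differentiableAt
  · rw [transition_apply_self hq]; exact h.nondeg.self_of_nhds
  · exact (eventually_mem_source hq).mono fun x hx ↦ chartMetric_transition S.g hx.1 hx.2

/-- The field `∇_X Y` in the chart at `p`. -/
theorem chartField_nabla (X : Π x : M, TangentSpace 𝓘(ℝ, E) x)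
    {Y : Π x : M, TangentSpace 𝓘(ℝ, E) x} (hY : IsSmoothField Y) (p : M) :
    chartField (nabla S.g X Y) p =ᶠ[𝓝 (extChartAt 𝓘(ℝ, E) p p)]
      coordNabla (chartMetric S.g p) (chartField X p) (chartField Y p) := by
  have hYp : ∀ᶠ x in 𝓝 (extChartAt 𝓘(ℝ, E) p p), ContDiffAt ℝ 1 (chartField Y p) x :=
    ((hY.contDiffAt_chartField p).of_le (by simp : (1 : WithTop ℕ∞) ≤ ∞)).eventually (by simp)
  filter_upwards [hYp, extChartAt_target_mem_nhds (I := 𝓘(ℝ, E)) p] with x hYx hx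
  set q := (extChartAt 𝓘(ℝ, E) p).symm x with hqx
  have hq : q ∈ (extChartAt 𝓘(ℝ, E) p).source := (extChartAt 𝓘(ℝ, E) p).map_target hx
  have hxq : x = extChartAt 𝓘(ℝ, E) p q := ((extChartAt 𝓘(ℝ, E) p).right_inv hx).symm
  have hi := mem_extChartAt_source (I := 𝓘(ℝ, E)) q
  have h := isMetricAt_chartMetric S q
  have h1 := nabla_eq_coordNabla h.differentiableAt X
    ((hY.contDiffAt_chartField q).differentiableAt (by simp))
  have ht := transition_apply_self hq
  have hev := eventually_mem_source hq
  -- At the nearby point `q` the value of $\nabla_XY$ is computed in the chart at `q`; invariance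
  -- under the transition map carries it to the chart at `p`.
  have h2 : coordNabla (chartMetric S.g q) (chartField X q) (chartField Y q)
      (transition 𝓘(ℝ, E) p q (extChartAt 𝓘(ℝ, E) p q)) = _ :=
    coordNabla_pullback (G' := chartMetric S.g p) (X' := chartField X p) (Y' := chartField Y p)
    (contDiffAt_transition hq) (surjective_fderiv_transition hq)
    (by rw [ht]; exact h.differentiableAt) h.symm (by rw [ht]; exact h.nondeg.self_of_nhds)
    (chartMetric_nondeg S p ((extChartAt 𝓘(ℝ, E) p).map_source hq))
    (hev.mono fun x hx ↦ chartMetric_transition S.g hx.1 hx.2)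
    (chartField_transition X hev.self_of_nhds.1 hev.self_of_nhds.2)
    (by rw [ht]; exact (hY.contDiffAt_chartField q).differentiableAt (by simp))
    (by rw [← hxq]; exact hYx.differentiableAt (by simp))
    (hev.mono fun x hx ↦ chartField_transition Y hx.1 hx.2)
  rw [ht, ← h1, fderiv_transition, ← hxq] at h2
  rw [chartField, Function.comp_apply, trivializationAt_snd, ← hqx]
  refine (congrArg (tangentCoordChange 𝓘(ℝ, E) q p q) h2).trans ?_
  exact tangentCoordChange_inv hi hq _

-- The bracket is defined by pulling back through the chart. The pulled-back fields are the chart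
-- components near the centre, and the derivative of the chart at its centre is the identity.
omit [FiniteDimensional ℝ E] in
theorem mlieBracket_eq_coordBracket (X Y : Π x : M, TangentSpace 𝓘(ℝ, E) x) (p : M) :
    (VectorField.mlieBracket 𝓘(ℝ, E) X Y p : E) =
      coordBracket (chartField X p) (chartField Y p) (extChartAt 𝓘(ℝ, E) p p) := by
  have h1 (X : Π x : M, TangentSpace 𝓘(ℝ, E) x) :
      (VectorField.mpullbackWithin 𝓘(ℝ, E) 𝓘(ℝ, E) (extChartAt 𝓘(ℝ, E) p).symm X
        (Set.range 𝓘(ℝ, E)) : E → E) =ᶠ[𝓝 (extChartAt 𝓘(ℝ, E) p p)] chartField X p := by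
    filter_upwards [extChartAt_target_mem_nhds (I := 𝓘(ℝ, E)) p] with x hx
    set q := (extChartAt 𝓘(ℝ, E) p).symm x with hqx
    have hq : q ∈ (extChartAt 𝓘(ℝ, E) p).source := (extChartAt 𝓘(ℝ, E) p).map_target hx
    have hi := mem_extChartAt_source (I := 𝓘(ℝ, E)) q
    have hxq : extChartAt 𝓘(ℝ, E) p q = x := (extChartAt 𝓘(ℝ, E) p).right_inv hx
    rw [chartField, Function.comp_apply, trivializationAt_snd, VectorField.mpullbackWithin_apply]
    have h2 := TangentBundle.symmL_trivializationAt (I := 𝓘(ℝ, E)) (x₀ := p) (x := q)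
      (by simpa using hq)
    rw [TangentBundle.symmL_trivializationAt_eq_core (by simpa using hq), hxq] at h2
    refine (congrArg (fun L : E →L[ℝ] E ↦ L.inverse (X q : E)) h2.symm).trans ?_
    let e : E ≃L[ℝ] E := ContinuousLinearEquiv.equivOfInverse (tangentCoordChange 𝓘(ℝ, E) p q q)
      (tangentCoordChange 𝓘(ℝ, E) q p q) (tangentCoordChange_inv hi hq)
      (tangentCoordChange_inv hq hi)
    have he := ContinuousLinearMap.inverse_equiv e
    exact congrArg (fun L : E →L[ℝ] E ↦ L (X q : E)) he
  have h3 : (VectorField.mlieBracket 𝓘(ℝ, E) X Y p : E) = VectorField.lieBracketWithin ℝ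
      (VectorField.mpullbackWithin 𝓘(ℝ, E) 𝓘(ℝ, E) (extChartAt 𝓘(ℝ, E) p).symm X
        (Set.range 𝓘(ℝ, E)))
      (VectorField.mpullbackWithin 𝓘(ℝ, E) 𝓘(ℝ, E) (extChartAt 𝓘(ℝ, E) p).symm Y
        (Set.range 𝓘(ℝ, E)))
      ((extChartAt 𝓘(ℝ, E) p).symm ⁻¹' Set.univ ∩ Set.range 𝓘(ℝ, E))
      (extChartAt 𝓘(ℝ, E) p p) := by
    have h4 : (mfderiv 𝓘(ℝ, E) 𝓘(ℝ, E) (extChartAt 𝓘(ℝ, E) p) p : E →L[ℝ] E) =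
        ContinuousLinearMap.id ℝ E := by
      have := TangentBundle.continuousLinearMapAt_trivializationAt (I := 𝓘(ℝ, E)) (x₀ := p)
        (x := p) (mem_chart_source E p)
      rw [TangentBundle.continuousLinearMapAt_trivializationAt_eq_core (mem_chart_source E p)]
        at this
      refine this.symm.trans ?_
      ext v
      exact tangentCoordChange_self (mem_extChartAt_source p)
    rw [← VectorField.mlieBracketWithin_univ, VectorField.mlieBracketWithin_apply]
    refine (congrArg (fun L : E →L[ℝ] E ↦ L.inverse _) h4).trans ?_
    rw [ContinuousLinearMap.inverse_id]
    rfl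
  let P (X : Π x : M, TangentSpace 𝓘(ℝ, E) x) : E → E :=
    VectorField.mpullbackWithin 𝓘(ℝ, E) 𝓘(ℝ, E) (extChartAt 𝓘(ℝ, E) p).symm X
      Set.univ
  rw [ModelWithCorners.range_eq_univ] at h1
  have h5 : VectorField.lieBracket ℝ (P X) (P Y) (extChartAt 𝓘(ℝ, E) p p) = _ :=
    (h1 X).lieBracket_vectorField_eq (h1 Y)
  rw [← VectorField.lieBracketWithin_univ] at h5
  rw [h3, ModelWithCorners.range_eq_univ, Set.preimage_univ, Set.univ_inter]
  exact h5.trans (congrFun VectorField.lieBracket_eq _)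

/-- The curvature operator in coordinates. -/
theorem curvature_eq_coordCurvature {X Y Z : Π x : M, TangentSpace 𝓘(ℝ, E) x}
    (hX : IsSmoothField X) (hY : IsSmoothField Y) (hZ : IsSmoothField Z) (p : M) :
    (curvature S.g X Y Z p : E) =
      coordCurvature (chartMetric S.g p) (extChartAt 𝓘(ℝ, E) p p) (X p) (Y p) (Z p) := by
  have h := isMetricAt_chartMetric S p
  have hZ' := hZ.contDiffAt_chartField p
  have hX' := (hX.contDiffAt_chartField p).differentiableAt (by simp)
  have hY' := (hY.contDiffAt_chartField p).differentiableAt (by simp)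
  have key := coordCurvature_eq h.differentiableAt_christoffel hX' hY' hZ'
  -- The outer derivative sees the inner field on a neighbourhood, so the germ equality
  -- `chartField_nabla` is needed.
  have e (X : Π x : M, TangentSpace 𝓘(ℝ, E) x) {Y : Π x : M, TangentSpace 𝓘(ℝ, E) x}
      (hY : IsSmoothField Y) (hX : IsSmoothField X) (W : Π x : M, TangentSpace 𝓘(ℝ, E) x) :
      (nabla S.g W (nabla S.g X Y) p : E) = coordNabla (chartMetric S.g p) (chartField W p)
        (coordNabla (chartMetric S.g p) (chartField X p) (chartField Y p))
        (extChartAt 𝓘(ℝ, E) p p) := by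
    have hev := chartField_nabla S X hY p
    have hd := differentiableAt_coordNabla h.differentiableAt_christoffel
      ((hX.contDiffAt_chartField p).differentiableAt (by simp)) (hY.contDiffAt_chartField p)
    rw [nabla_eq_coordNabla h.differentiableAt W (hd.congr_of_eventuallyEq hev), coordNabla,
      hev.fderiv_eq, hev.self_of_nhds]
    rfl
  have hL := leviCivita_eq h.differentiableAt (hZ'.differentiableAt (by simp))
    (VectorField.mlieBracket 𝓘(ℝ, E) X Y p)
  rw [mlieBracket_eq_coordBracket] at hL
  rw [← hL, ← e Y hZ hY X, ← e X hZ hX Y, chartField_self, chartField_self, chartField_self]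
    at key
  rw [← key, ← mlieBracket_eq_coordBracket]
  rfl

end BaseCharts

/-! ### Induced charts of the tangent bundle -/

section TangentCharts

variable {E : Type*} [NormedAddCommGroup E] [NormedSpace ℝ E]
  {M : Type*} [TopologicalSpace M] [ChartedSpace E M] [IsManifold 𝓘(ℝ, E) ∞ M]

theorem extChartAt_tangent_apply (u w : TangentBundle 𝓘(ℝ, E) M) :
    extChartAt 𝓘(ℝ, E).tangent u w = (extChartAt 𝓘(ℝ, E) u.proj w.proj,
      tangentCoordChange 𝓘(ℝ, E) w.proj u.proj w.proj w.snd) := rfl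

theorem mem_extChartAt_tangent_source {u w : TangentBundle 𝓘(ℝ, E) M} :
    w ∈ (extChartAt 𝓘(ℝ, E).tangent u).source ↔ w.proj ∈ (extChartAt 𝓘(ℝ, E) u.proj).source := by
  rw [extChartAt_source, extChartAt_source]
  exact TangentBundle.mem_chart_source_iff w u

/-- The point of the tangent bundle with given coordinates in the chart at `u`. -/
def tangentPoint (u : TangentBundle 𝓘(ℝ, E) M) (z : E × E) : TangentBundle 𝓘(ℝ, E) M :=
  ⟨(extChartAt 𝓘(ℝ, E) u.proj).symm z.1,
    (tangentCoordChange 𝓘(ℝ, E) u.proj ((extChartAt 𝓘(ℝ, E) u.proj).symm z.1)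
      ((extChartAt 𝓘(ℝ, E) u.proj).symm z.1) z.2 : E)⟩

variable {u : TangentBundle 𝓘(ℝ, E) M} {z : E × E}

theorem extChartAt_tangentPoint (hz : z.1 ∈ (extChartAt 𝓘(ℝ, E) u.proj).target) :
    extChartAt 𝓘(ℝ, E).tangent u (tangentPoint u z) = z := by
  rw [extChartAt_tangent_apply]
  exact Prod.ext ((extChartAt 𝓘(ℝ, E) u.proj).right_inv hz)
    (tangentCoordChange_inv (mem_extChartAt_source _)
      ((extChartAt 𝓘(ℝ, E) u.proj).map_target hz) z.2)

theorem tangentPoint_mem_source (hz : z.1 ∈ (extChartAt 𝓘(ℝ, E) u.proj).target) :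
    tangentPoint u z ∈ (extChartAt 𝓘(ℝ, E).tangent u).source :=
  mem_extChartAt_tangent_source.2 ((extChartAt 𝓘(ℝ, E) u.proj).map_target hz)

theorem mem_target_tangent (hz : z.1 ∈ (extChartAt 𝓘(ℝ, E) u.proj).target) :
    z ∈ (extChartAt 𝓘(ℝ, E).tangent u).target := by
  have h := (extChartAt 𝓘(ℝ, E).tangent u).map_source (tangentPoint_mem_source hz)
  rwa [extChartAt_tangentPoint hz] at h

theorem extChartAt_tangent_symm_apply (hz : z.1 ∈ (extChartAt 𝓘(ℝ, E) u.proj).target) :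
    (extChartAt 𝓘(ℝ, E).tangent u).symm z = tangentPoint u z := by
  have h := (extChartAt 𝓘(ℝ, E).tangent u).left_inv (tangentPoint_mem_source hz)
  rwa [extChartAt_tangentPoint hz] at h

/-- The coordinate changes of the tangent bundle of `TM`. -/
theorem tangentCoordChange_tangent {w : TangentBundle 𝓘(ℝ, E) M}
    (hw : w.proj ∈ (extChartAt 𝓘(ℝ, E) u.proj).source) (a : E × E) :
    tangentCoordChange 𝓘(ℝ, E).tangent u w w a =
      (tangentCoordChange 𝓘(ℝ, E) u.proj w.proj w.proj a.1,
        fderiv ℝ (fderiv ℝ (transition 𝓘(ℝ, E) u.proj w.proj)) (extChartAt 𝓘(ℝ, E) u.proj w.proj)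
          a.1 (tangentCoordChange 𝓘(ℝ, E) w.proj u.proj w.proj w.snd) +
        tangentCoordChange 𝓘(ℝ, E) u.proj w.proj w.proj a.2) := by
  set p := u.proj
  set q := w.proj
  set z : E × E := extChartAt 𝓘(ℝ, E).tangent u w with hz
  have hφ := contDiffAt_transition hw
  have hφ1 : DifferentiableAt ℝ (transition 𝓘(ℝ, E) p q) z.1 := hφ.differentiableAt (by simp)
  have hDφ : DifferentiableAt ℝ (fderiv ℝ (transition 𝓘(ℝ, E) p q)) z.1 :=
    (hφ.fderiv_right (m := ∞) le_rfl).differentiableAt (by simp)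
  have h1 : HasFDerivAt (fun z : E × E ↦
      (transition 𝓘(ℝ, E) p q z.1, fderiv ℝ (transition 𝓘(ℝ, E) p q) z.1 z.2)) _ z :=
    (hφ1.hasFDerivAt.comp z hasFDerivAt_fst).prodMk
      ((hDφ.hasFDerivAt.comp z hasFDerivAt_fst).clm_apply hasFDerivAt_snd)
  -- The transition of $TM$ is $(x,y)\mapsto(\varphi(x),D\varphi(x)y)$; its derivative contains the
  -- term $D^2\varphi(a_1,y)$.
  have h2 : transition 𝓘(ℝ, E).tangent u w =ᶠ[𝓝 z] fun z : E × E ↦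
      (transition 𝓘(ℝ, E) p q z.1, fderiv ℝ (transition 𝓘(ℝ, E) p q) z.1 z.2) := by
    have hev : ∀ᶠ z' in 𝓝 z, z'.1 ∈ (extChartAt 𝓘(ℝ, E) p).target ∧
        (extChartAt 𝓘(ℝ, E) p).symm z'.1 ∈ (extChartAt 𝓘(ℝ, E) q).source :=
      (continuous_fst.tendsto z).eventually (eventually_mem_source hw)
    filter_upwards [hev] with z' hz'
    rw [transition, Function.comp_apply, extChartAt_tangent_symm_apply hz'.1,
      extChartAt_tangent_apply, fderiv_transition' hz'.1]
    refine Prod.ext rfl ?_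
    exact tangentCoordChange_comp ⟨⟨(extChartAt 𝓘(ℝ, E) p).map_target hz'.1,
      mem_extChartAt_source _⟩, hz'.2⟩
  rw [← fderiv_transition, ← hz, (h1.congr_of_eventuallyEq h2).fderiv]
  have hD : fderiv ℝ (transition 𝓘(ℝ, E) p q) z.1 = tangentCoordChange 𝓘(ℝ, E) p q q :=
    fderiv_transition p q q
  refine Prod.ext ?_ ?_
  · simp [hD]
  · exact (congrArg (fun L : E →L[ℝ] E ↦ L a.2 + fderiv ℝ (fderiv ℝ (transition 𝓘(ℝ, E) p q))
      z.1 a.1 z.2) hD).trans (add_comm _ _)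

variable [FiniteDimensional ℝ E] (S : AlmostSkewHermitian E M)

omit [FiniteDimensional ℝ E] in
theorem hPart_coordChange {w : TangentBundle 𝓘(ℝ, E) M}
    (hw : w.proj ∈ (extChartAt 𝓘(ℝ, E) u.proj).source) (a : E × E) :
    (hPart w (tangentCoordChange 𝓘(ℝ, E).tangent u w w a) : E) =
      tangentCoordChange 𝓘(ℝ, E) u.proj w.proj w.proj a.1 := by
  rw [tangentCoordChange_tangent hw]
  rfl

/-- The connection map in the chart of `TM` at `u`. -/
theorem vPart_coordChange {w : TangentBundle 𝓘(ℝ, E) M}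
    (hw : w.proj ∈ (extChartAt 𝓘(ℝ, E) u.proj).source) (a : E × E) :
    (vPart S.g w (tangentCoordChange 𝓘(ℝ, E).tangent u w w a) : E) =
      tangentCoordChange 𝓘(ℝ, E) u.proj w.proj w.proj
        (coordConn (chartMetric S.g u.proj) (extChartAt 𝓘(ℝ, E).tangent u w) a) := by
  have hi := mem_extChartAt_source (I := 𝓘(ℝ, E)) w.proj
  set y : E := tangentCoordChange 𝓘(ℝ, E) w.proj u.proj w.proj w.snd with hy
  have hsnd : (w.snd : E) = tangentCoordChange 𝓘(ℝ, E) u.proj w.proj w.proj y :=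
    (tangentCoordChange_inv hw hi _).symm
  -- The inhomogeneous $D^2\varphi$ term here is the one in the coordinate change of $TM$, up to the
  -- order of its arguments; hence the connection map transforms tensorially.
  have key := christoffel_transition S hw y a.1
  have hsym : fderiv ℝ (fderiv ℝ (transition 𝓘(ℝ, E) u.proj w.proj))
      (extChartAt 𝓘(ℝ, E) u.proj w.proj) y a.1 = fderiv ℝ (fderiv ℝ
        (transition 𝓘(ℝ, E) u.proj w.proj)) (extChartAt 𝓘(ℝ, E) u.proj w.proj) a.1 y :=
    ((contDiffAt_transition hw).isSymmSndFDerivAt two_le_infty).eq _ _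
  rw [tangentCoordChange_tangent hw, coordConn_apply, extChartAt_tangent_apply, map_add, ← hy,
    ← key, hsym, ← hsnd]
  change (_ + _ + _ : E) = _
  abel

omit [FiniteDimensional ℝ E] in
theorem chartField_eq_of_eq {N H V : Type*} [NormedAddCommGroup V] [NormedSpace ℝ V]
    [TopologicalSpace H] {I : ModelWithCorners ℝ V H} [TopologicalSpace N] [ChartedSpace H N]
    [IsManifold I 1 N] {Y : Π x : N, TangentSpace I x} {p : N} {x a : V}
    (hx : x ∈ (extChartAt I p).target)
    (h : (Y ((extChartAt I p).symm x) : V) =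
      tangentCoordChange I p ((extChartAt I p).symm x) ((extChartAt I p).symm x) a) :
    chartField Y p x = a := by
  rw [chartField, Function.comp_apply, trivializationAt_snd]
  refine (congrArg (tangentCoordChange I _ p _) h).trans ?_
  exact tangentCoordChange_inv (mem_extChartAt_source _) ((extChartAt I p).map_target hx) a

omit [FiniteDimensional ℝ E] in
theorem tangent_symm_proj (hz : z.1 ∈ (extChartAt 𝓘(ℝ, E) u.proj).target) :
    ((extChartAt 𝓘(ℝ, E).tangent u).symm z).proj = (extChartAt 𝓘(ℝ, E) u.proj).symm z.1 := by
  rw [extChartAt_tangent_symm_apply hz]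
  rfl

omit [FiniteDimensional ℝ E] in
theorem coordChange_chartField (X : Π x : M, TangentSpace 𝓘(ℝ, E) x) {p : M} {x : E}
    (hx : x ∈ (extChartAt 𝓘(ℝ, E) p).target) {q : M} (hq : q = (extChartAt 𝓘(ℝ, E) p).symm x) :
    tangentCoordChange 𝓘(ℝ, E) p q q (chartField X p x) = (X q : E) := by
  subst hq
  exact tangentCoordChange_inv ((extChartAt 𝓘(ℝ, E) p).map_target hx) (mem_extChartAt_source _) _

omit [FiniteDimensional ℝ E] in
theorem chartField_vertLift (X : Π x : M, TangentSpace 𝓘(ℝ, E) x)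
    (hz : z.1 ∈ (extChartAt 𝓘(ℝ, E) u.proj).target) :
    chartField (vertLift X) u z = coordVert (chartField X u.proj) z := by
  refine chartField_eq_of_eq (mem_target_tangent hz) ?_
  set w := (extChartAt 𝓘(ℝ, E).tangent u).symm z with hw
  have hp := tangent_symm_proj hz
  have hs : w.proj ∈ (extChartAt 𝓘(ℝ, E) u.proj).source := by
    rw [hp]; exact (extChartAt 𝓘(ℝ, E) u.proj).map_target hz
  rw [tangentCoordChange_tangent hs, coordVert, coordChange_chartField X hz hp, map_zero, map_zero,
    zero_apply]
  exact Prod.ext rfl (zero_add (X w.proj : E)).symm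

theorem chartField_horizLift (X : Π x : M, TangentSpace 𝓘(ℝ, E) x)
    (hz : z.1 ∈ (extChartAt 𝓘(ℝ, E) u.proj).target) :
    chartField (horizLift S.g X) u z =
      coordHoriz (chartMetric S.g u.proj) (chartField X u.proj) z := by
  refine chartField_eq_of_eq (mem_target_tangent hz) ?_
  set w := (extChartAt 𝓘(ℝ, E).tangent u).symm z with hw
  have hp := tangent_symm_proj hz
  have hs : w.proj ∈ (extChartAt 𝓘(ℝ, E) u.proj).source := by
    rw [hp]; exact (extChartAt 𝓘(ℝ, E) u.proj).map_target hz
  have hz' : extChartAt 𝓘(ℝ, E).tangent u w = z :=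
    (extChartAt 𝓘(ℝ, E).tangent u).right_inv (mem_target_tangent hz)
  set b : E × E := tangentCoordChange 𝓘(ℝ, E).tangent u w w
    (coordHoriz (chartMetric S.g u.proj) (chartField X u.proj) z) with hb
  -- A vector is determined by its horizontal and vertical parts: here $X$ and zero.
  have h1 : b.1 = (X w.proj : E) :=
    (hPart_coordChange hs _).trans (coordChange_chartField X hz hp)
  have h2 : b.2 + (christoffel S.g w.proj w.snd b.1 : E) = 0 := by
    refine (vPart_coordChange S hs _).trans ?_
    rw [hz', coordConn_horiz, map_zero]
  rw [h1] at h2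
  exact (Prod.ext h1 (eq_neg_of_add_eq_zero_left h2)).symm

/-- The metric is built from `hPart` and `vPart`, and both transform tensorially. -/
theorem chartMetric_sasaki
    (hz : z.1 ∈ (extChartAt 𝓘(ℝ, E) u.proj).target) :
    chartMetric (sasaki S.g) u z = coordSasaki (chartMetric S.g u.proj) z := by
  refine ContinuousLinearMap.ext fun a ↦ ContinuousLinearMap.ext fun b ↦ ?_
  rw [chartMetric_apply _ (mem_target_tangent hz), coordSasaki_apply, chartMetric_apply _ hz,
    chartMetric_apply _ hz]
  set w := (extChartAt 𝓘(ℝ, E).tangent u).symm z with hw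
  have hp : w.proj = (extChartAt 𝓘(ℝ, E) u.proj).symm z.1 := tangent_symm_proj hz
  have hs : w.proj ∈ (extChartAt 𝓘(ℝ, E) u.proj).source := by
    rw [hp]; exact (extChartAt 𝓘(ℝ, E) u.proj).map_target hz
  have hz' : extChartAt 𝓘(ℝ, E).tangent u w = z :=
    (extChartAt 𝓘(ℝ, E).tangent u).right_inv (mem_target_tangent hz)
  have hv (a : E × E) := vPart_coordChange S hs a
  rw [hz'] at hv
  rw [← hp, ← hv, ← hv, ← hPart_coordChange hs, ← hPart_coordChange hs]
  rfl

end TangentCharts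

/-! ### Covariant derivative of a negated field -/

section Negation

variable {E : Type*} [NormedAddCommGroup E] [NormedSpace ℝ E]
  {H : Type*} [TopologicalSpace H] {I : ModelWithCorners ℝ E H}
  {N : Type*} [TopologicalSpace N] [ChartedSpace H N] [IsManifold I 1 N]

/-- Needed because $J_1$ and $J_3$ send some lifts to negatives of lifts. No regularity of $Y$
enters, as the derivative commutes with negation unconditionally. -/
theorem nabla_neg (g : Π x : N, TangentSpace I x →L[ℝ] TangentSpace I x →L[ℝ] ℝ)
    (X Y : Π x : N, TangentSpace I x) (p : N) :
    nabla g X (fun q ↦ -Y q) p = -nabla g X Y p := by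
  have h1 : (fun q ↦ (trivializationAt E (TangentSpace I) p ⟨q, -Y q⟩).2) =
      -(fun q ↦ (trivializationAt E (TangentSpace I) p ⟨q, Y q⟩).2 : N → E) := by
    ext q
    exact map_neg (tangentCoordChange I q p q) (Y q : E)
  have h2 : (mvfderiv I (fun q ↦ (trivializationAt E (TangentSpace I) p ⟨q, -Y q⟩).2) p
      : E →L[ℝ] E) = -mvfderiv I (fun q ↦ (trivializationAt E (TangentSpace I) p ⟨q, Y q⟩).2) p := by
    rw [h1]
    exact mvfderiv_neg
  have h3 : (christoffel g p (X p : E) (-Y p : E) : E) = -(christoffel g p (X p : E) (Y p : E)) :=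
    map_neg (christoffel g p (X p : E)) (Y p : E)
  have h4 := congrArg (fun L : E →L[ℝ] E ↦ L (X p : E)) h2
  exact (congrArg₂ (fun a b : E ↦ a + b) h4 h3).trans (neg_add _ _).symm

end Negation

/-! ### Adjoints of the three structures and the connection on lifts -/

section Components

variable {E : Type*} [NormedAddCommGroup E] [NormedSpace ℝ E]
  {M : Type*} [TopologicalSpace M] [ChartedSpace E M] [IsManifold 𝓘(ℝ, E) ∞ M]
  (S : AlmostSkewHermitian E M) {X Y Z : Π x : M, TangentSpace 𝓘(ℝ, E) x}
  (u : TangentBundle 𝓘(ℝ, E) M)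

/-- Replace $w$ by $Jw$ in the anti-isometry and use $J^2=-1$: $J$ is self-adjoint, whereas in the
Hermitian case it is skew. -/
theorem AlmostSkewHermitian.g_J_left (p : M) (v w : TangentSpace 𝓘(ℝ, E) p) :
    S.g p (S.J p v) w = S.g p v (S.J p w) := by
  have h := S.anti_isometry p v (S.J p w)
  rw [S.J_sq, map_neg] at h
  exact neg_injective h

theorem sasaki_horizLift (ξ : TangentSpace 𝓘(ℝ, E).tangent u) :
    sasaki S.g u ξ (horizLift S.g Z u) = S.g u.proj (hPart u ξ) (Z u.proj) := by
  rw [sasaki_apply, horizLift, hPart_horiz, vPart_horiz, map_zero, add_zero]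

theorem sasaki_vertLift (ξ : TangentSpace 𝓘(ℝ, E).tangent u) :
    sasaki S.g u ξ (vertLift Z u) = S.g u.proj (vPart S.g u ξ) (Z u.proj) := by
  rw [sasaki_apply, vertLift, hPart_vert, vPart_vert, map_zero, zero_add]

/-- This and the five lemmas after it move each structure onto the last argument, leaving only
components of $\hat\nabla$ on lifts. -/
theorem sasaki_J₁_horizLift (ξ : TangentSpace 𝓘(ℝ, E).tangent u) :
    sasaki S.g u (J₁ S.g u ξ) (horizLift S.g Z u) = -sasaki S.g u ξ (vertLift Z u) := by
  rw [sasaki_horizLift, sasaki_vertLift]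
  simp [J₁]

theorem sasaki_J₁_vertLift (ξ : TangentSpace 𝓘(ℝ, E).tangent u) :
    sasaki S.g u (J₁ S.g u ξ) (vertLift Z u) = sasaki S.g u ξ (horizLift S.g Z u) := by
  rw [sasaki_horizLift, sasaki_vertLift]
  simp [J₁]

theorem sasaki_J₂_horizLift (ξ : TangentSpace 𝓘(ℝ, E).tangent u) :
    sasaki S.g u (J₂ S.g S.J u ξ) (horizLift S.g Z u) =
      sasaki S.g u ξ (vertLift (act S.J Z) u) := by
  rw [sasaki_horizLift, sasaki_vertLift]
  simp [J₂, act, S.g_J_left]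

theorem sasaki_J₂_vertLift (ξ : TangentSpace 𝓘(ℝ, E).tangent u) :
    sasaki S.g u (J₂ S.g S.J u ξ) (vertLift Z u) =
      sasaki S.g u ξ (horizLift S.g (act S.J Z) u) := by
  rw [sasaki_horizLift, sasaki_vertLift]
  simp [J₂, act, S.g_J_left]

theorem sasaki_J₃_horizLift (ξ : TangentSpace 𝓘(ℝ, E).tangent u) :
    sasaki S.g u (J₃ S.g S.J u ξ) (horizLift S.g Z u) =
      -sasaki S.g u ξ (horizLift S.g (act S.J Z) u) := by
  rw [← sasaki_J₂_vertLift, ← sasaki_J₁_horizLift]; rfl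

theorem sasaki_J₃_vertLift (ξ : TangentSpace 𝓘(ℝ, E).tangent u) :
    sasaki S.g u (J₃ S.g S.J u ξ) (vertLift Z u) =
      sasaki S.g u ξ (vertLift (act S.J Z) u) := by
  rw [← sasaki_J₂_horizLift, ← sasaki_J₁_vertLift]; rfl

theorem act_J₁_horizLift : act (J₁ S.g) (horizLift S.g Y) = vertLift Y :=
  funext fun w ↦ J₁_horiz S.g w (Y w.proj)

theorem act_J₁_vertLift : act (J₁ S.g) (vertLift Y) = fun w ↦ -horizLift S.g Y w :=
  funext fun w ↦ J₁_vert S.g w (Y w.proj)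

theorem act_J₂_horizLift : act (J₂ S.g S.J) (horizLift S.g Y) = vertLift (act S.J Y) :=
  funext fun w ↦ J₂_horiz S.g S.J w (Y w.proj)

theorem act_J₂_vertLift : act (J₂ S.g S.J) (vertLift Y) = horizLift S.g (act S.J Y) :=
  funext fun w ↦ J₂_vert S.g S.J w (Y w.proj)

theorem act_J₃_horizLift :
    act (J₃ S.g S.J) (horizLift S.g Y) = fun w ↦ -horizLift S.g (act S.J Y) w :=
  funext fun w ↦ (congrArg (J₁ S.g w) (J₂_horiz S.g S.J w (Y w.proj))).trans (J₁_vert S.g w _)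

theorem act_J₃_vertLift : act (J₃ S.g S.J) (vertLift Y) = vertLift (act S.J Y) :=
  funext fun w ↦ (congrArg (J₁ S.g w) (J₂_vert S.g S.J w (Y w.proj))).trans (J₁_horiz S.g w _)

theorem structuralTensor_sasaki
    (𝒥 : Π w : TangentBundle 𝓘(ℝ, E) M,
      TangentSpace 𝓘(ℝ, E).tangent w →L[ℝ] TangentSpace 𝓘(ℝ, E).tangent w)
    (A B C : Π w : TangentBundle 𝓘(ℝ, E) M, TangentSpace 𝓘(ℝ, E).tangent w) :
    structuralTensor (sasaki S.g) 𝒥 A B C u =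
      sasaki S.g u (nabla (sasaki S.g) A (act 𝒥 B) u) (C u) -
        sasaki S.g u (𝒥 u (nabla (sasaki S.g) A B u)) (C u) := by
  rw [structuralTensor, map_sub]; rfl

theorem structuralTensor_base (p : M) : structuralTensor S.g S.J X Y Z p =
    S.g p (nabla S.g X (act S.J Y) p) (Z p) - S.g p (nabla S.g X Y p) (act S.J Z p) := by
  rw [structuralTensor, map_sub, act, ← S.g_J_left]; rfl

theorem sasaki_nabla_neg_horizLift
    (A C : Π w : TangentBundle 𝓘(ℝ, E) M, TangentSpace 𝓘(ℝ, E).tangent w) :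
    sasaki S.g u (nabla (sasaki S.g) A (fun w ↦ -horizLift S.g Y w) u) (C u) =
      -sasaki S.g u (nabla (sasaki S.g) A (horizLift S.g Y) u) (C u) := by
  rw [nabla_neg, map_neg]; rfl

variable [FiniteDimensional ℝ E]

theorem curvature₄_eq (hX : IsSmoothField X) (hY : IsSmoothField Y) (hZ : IsSmoothField Z)
    (p : M) (w : E) :
    curvature₄ S.g X Y Z p w = modelForm S.g p
      (coordCurvature (chartMetric S.g p) (extChartAt 𝓘(ℝ, E) p p)
        (chartField X p (extChartAt 𝓘(ℝ, E) p p)) (chartField Y p (extChartAt 𝓘(ℝ, E) p p))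
        (chartField Z p (extChartAt 𝓘(ℝ, E) p p))) w := by
  rw [chartField_self, chartField_self, chartField_self]
  exact congrArg (fun v : E ↦ modelForm S.g p v w) (curvature_eq_coordCurvature S hX hY hZ p)

theorem curvature₄_swap (hX : IsSmoothField X) (hY : IsSmoothField Y) (hZ : IsSmoothField Z)
    (p : M) (w : E) : curvature₄ S.g X Y Z p w = -curvature₄ S.g Y X Z p w := by
  rw [curvature₄_eq S hX hY hZ, curvature₄_eq S hY hX hZ, coordCurvature_swap, map_neg, neg_apply]

theorem curvature₄_bianchi (hX : IsSmoothField X) (hY : IsSmoothField Y) (hZ : IsSmoothField Z)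
    (p : M) (w : E) :
    curvature₄ S.g X Y Z p w + curvature₄ S.g Y Z X p w + curvature₄ S.g Z X Y p w = 0 := by
  rw [curvature₄_eq S hX hY hZ, curvature₄_eq S hY hZ hX, curvature₄_eq S hZ hX hY, ← add_apply,
    ← add_apply, ← map_add, ← map_add, coordCurvature_bianchi (isMetricAt_chartMetric S p),
    map_zero, zero_apply]

/-- The components on lifts of the Levi-Civita connection of the Sasaki metric. -/
theorem sasaki_nabla_lifts (hX : IsSmoothField X) (hY : IsSmoothField Y) (hZ : IsSmoothField Z) :
    let K (A B C : Π w : TangentBundle 𝓘(ℝ, E) M, TangentSpace 𝓘(ℝ, E).tangent w) : ℝ :=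
      sasaki S.g u (nabla (sasaki S.g) A B u) (C u)
    let R (A B C : Π x : M, TangentSpace 𝓘(ℝ, E) x) : ℝ := curvature₄ S.g A B C u.proj u.snd
    let L := horizLift S.g
    K (L X) (L Y) (L Z) = S.g u.proj (nabla S.g X Y u.proj) (Z u.proj) ∧
    K (L X) (L Y) (vertLift Z) = 1 / 2 * R X Y Z ∧
    K (L X) (vertLift Y) (L Z) = -(1 / 2) * R X Z Y ∧
    K (L X) (vertLift Y) (vertLift Z) = S.g u.proj (nabla S.g X Y u.proj) (Z u.proj) ∧
    K (vertLift X) (L Y) (L Z) = -(1 / 2) * R Y Z X ∧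
    K (vertLift X) (L Y) (vertLift Z) = 0 ∧
    K (vertLift X) (vertLift Y) (L Z) = 0 ∧
    K (vertLift X) (vertLift Y) (vertLift Z) = 0 := by
  intro K R L
  set p := u.proj
  set z : E × E := extChartAt 𝓘(ℝ, E).tangent u u with hz
  have hz2 : z.2 = (u.snd : E) := tangentCoordChange_self (mem_extChartAt_source p)
  have hm : IsMetricAt (chartMetric S.g p) z.1 := isMetricAt_chartMetric S p
  have d {X : Π x : M, TangentSpace 𝓘(ℝ, E) x} (hX : IsSmoothField X) :
      DifferentiableAt ℝ (chartField X p) z.1 :=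
    (hX.contDiffAt_chartField p).differentiableAt (by simp)
  have hev : ∀ᶠ z' in 𝓝 z, z'.1 ∈ (extChartAt 𝓘(ℝ, E) p).target :=
    (continuous_fst.tendsto z).eventually (extChartAt_target_mem_nhds (I := 𝓘(ℝ, E)) p)
  have hG : chartMetric (sasaki S.g) u =ᶠ[𝓝 z] coordSasaki (chartMetric S.g p) :=
    hev.mono fun _ h ↦ chartMetric_sasaki S h
  have hGd : DifferentiableAt ℝ (chartMetric (sasaki S.g) u) z :=
    (differentiableAt_coordSasaki hm.differentiableAt
      hm.differentiableAt_christoffel).congr_of_eventuallyEq hG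
  have hH (X : Π x : M, TangentSpace 𝓘(ℝ, E) x) : chartField (horizLift S.g X) u =ᶠ[𝓝 z]
      coordHoriz (chartMetric S.g p) (chartField X p) :=
    hev.mono fun _ h ↦ chartField_horizLift S X h
  have hV (X : Π x : M, TangentSpace 𝓘(ℝ, E) x) : chartField (vertLift X) u =ᶠ[𝓝 z]
      coordVert (chartField X p) :=
    hev.mono fun _ h ↦ chartField_vertLift X h
  have hHd {X : Π x : M, TangentSpace 𝓘(ℝ, E) x} (hX : IsSmoothField X) :
      DifferentiableAt ℝ (coordHoriz (chartMetric S.g p) (chartField X p)) z :=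
    differentiableAt_coordHoriz hm.differentiableAt_christoffel (d hX)
  have hVd {X : Π x : M, TangentSpace 𝓘(ℝ, E) x} (hX : IsSmoothField X) :
      DifferentiableAt ℝ (coordVert (chartField X p)) z :=
    (hasFDerivAt_coordVert (d hX)).differentiableAt
  -- The connection at `u` depends only on the germs of the metric and the differentiated field and
  -- on the value of the direction, so all may be replaced by their coordinate models.
  have hK {A B C : Π w : TangentBundle 𝓘(ℝ, E) M, TangentSpace 𝓘(ℝ, E).tangent w}
      {A' B' C' : E × E → E × E} (hA : chartField A u =ᶠ[𝓝 z] A')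
      (hB : chartField B u =ᶠ[𝓝 z] B') (hC : chartField C u =ᶠ[𝓝 z] C')
      (hBd : DifferentiableAt ℝ B' z) :
      K A B C = coordSasaki (chartMetric S.g p) z
        (coordNabla (coordSasaki (chartMetric S.g p)) A' B' z) (C' z) := by
    have h1 : (nabla (sasaki S.g) A B u : E × E) =
        coordNabla (coordSasaki (chartMetric S.g p)) A' B' z := by
      rw [nabla_eq_coordNabla hGd A (hBd.congr_of_eventuallyEq hB), coordNabla, coordNabla,
        coordChristoffel, coordChristoffel, ← hz, hB.fderiv_eq, hG.fderiv_eq, hA.self_of_nhds,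
        hB.self_of_nhds, hG.self_of_nhds]
    have h2 : (C u : E × E) = C' z := (chartField_self C u).symm.trans hC.self_of_nhds
    have h3 : modelForm (sasaki S.g) u = coordSasaki (chartMetric S.g p) z :=
      (chartMetric_self (sasaki S.g) u).symm.trans hG.self_of_nhds
    rw [← h1, ← h2, ← h3]
    rfl
  have hself (X : Π x : M, TangentSpace 𝓘(ℝ, E) x) : chartField X p z.1 = (X p : E) :=
    chartField_self X p
  have hGs : chartMetric S.g p z.1 = modelForm S.g p := chartMetric_self S.g p
  have hN {X Y : Π x : M, TangentSpace 𝓘(ℝ, E) x} (hY : IsSmoothField Y) :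
      coordNabla (chartMetric S.g p) (chartField X p) (chartField Y p) z.1 =
        (nabla S.g X Y p : E) :=
    (nabla_eq_coordNabla hm.differentiableAt X (d hY)).symm
  have hR {X Y Z : Π x : M, TangentSpace 𝓘(ℝ, E) x} (hX : IsSmoothField X)
      (hY : IsSmoothField Y) (hZ : IsSmoothField Z) : R X Y Z = modelForm S.g p
        (coordCurvature (chartMetric S.g p) z.1 (chartField X p z.1) (chartField Y p z.1)
          (chartField Z p z.1)) z.2 := by
    rw [hz2]
    exact curvature₄_eq S hX hY hZ p u.snd
  obtain ⟨h1, h2, h3, h4, h5, h6, h7, h8⟩ := sasaki_nabla_components hm (d hX) (d hY) (d hZ)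
  simp only [hself, hGs, hN hY] at h1 h4
  simp only [hGs] at h2 h3 h5
  rw [hR hX hY hZ, hR hX hZ hY, hR hY hZ hX]
  exact ⟨(hK (hH X) (hH Y) (hH Z) (hHd hY)).trans h1, (hK (hH X) (hH Y) (hV Z) (hHd hY)).trans h2,
    (hK (hH X) (hV Y) (hH Z) (hVd hY)).trans h3, (hK (hH X) (hV Y) (hV Z) (hVd hY)).trans h4,
    (hK (hV X) (hH Y) (hH Z) (hHd hY)).trans h5, (hK (hV X) (hH Y) (hV Z) (hHd hY)).trans h6,
    (hK (hV X) (hV Y) (hH Z) (hVd hY)).trans h7, (hK (hV X) (hV Y) (hV Z) (hVd hY)).trans h8⟩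

end Components

end SasakiLift

end

/-! ### The components of the three structural tensors -/

open SasakiLift in
theorem mainTheorem9 {E : Type*} [NormedAddCommGroup E] [NormedSpace ℝ E] [FiniteDimensional ℝ E]
    {M : Type*} [TopologicalSpace M] [T2Space M] [SecondCountableTopology M]
    [ChartedSpace E M] [IsManifold 𝓘(ℝ, E) ∞ M]
    (S : AlmostSkewHermitian E M)
    (X Y Z : Π x : M, TangentSpace 𝓘(ℝ, E) x)
    (hX : IsSmoothField X) (hY : IsSmoothField Y) (hZ : IsSmoothField Z)
    (u : TangentBundle 𝓘(ℝ, E) M) :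
    let R (A B C : Π x : M, TangentSpace 𝓘(ℝ, E) x) : ℝ := curvature₄ S.g A B C u.proj u.snd
    let F : ℝ := structuralTensor S.g S.J X Y Z u.proj
    let J := act S.J
    let F₁ (A B C : Π w : TangentBundle 𝓘(ℝ, E) M, TangentSpace 𝓘(ℝ, E).tangent w) : ℝ :=
      structuralTensor (sasaki S.g) (J₁ S.g) A B C u
    let F₂ (A B C : Π w : TangentBundle 𝓘(ℝ, E) M, TangentSpace 𝓘(ℝ, E).tangent w) : ℝ :=
      structuralTensor (sasaki S.g) (J₂ S.g S.J) A B C u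
    let F₃ (A B C : Π w : TangentBundle 𝓘(ℝ, E) M, TangentSpace 𝓘(ℝ, E).tangent w) : ℝ :=
      structuralTensor (sasaki S.g) (J₃ S.g S.J) A B C u
    let XH := horizLift S.g X
    let YH := horizLift S.g Y
    let ZH := horizLift S.g Z
    let XV := vertLift X
    let YV := vertLift Y
    let ZV := vertLift Z
    -- the components of `F₁`
    (F₁ XH YH ZH = -(1 / 2) * R Y Z X ∧
      F₁ XH YV ZV = 1 / 2 * R Y Z X ∧
      F₁ XV YH ZV = 1 / 2 * R Y Z X ∧
      F₁ XV YV ZH = 1 / 2 * R Y Z X ∧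
      F₁ XH YH ZV = 0 ∧ F₁ XH YV ZH = 0 ∧ F₁ XV YH ZH = 0 ∧ F₁ XV YV ZV = 0) ∧
    -- the components of `F₂`
    (F₂ XH YH ZH = -(1 / 2) * R X Y (J Z) + 1 / 2 * R Z X (J Y) ∧
      F₂ XH YV ZV = 1 / 2 * R X (J Y) Z - 1 / 2 * R (J Z) X Y ∧
      F₂ XH YH ZV = F ∧
      F₂ XH YV ZH = F ∧
      F₂ XV YH ZV = 1 / 2 * R Y (J Z) X ∧
      F₂ XV YV ZH = -(1 / 2) * R (J Y) Z X ∧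
      F₂ XV YH ZH = 0 ∧ F₂ XV YV ZV = 0) ∧
    -- the components of `F₃`
    (F₃ XH YH ZH = -F ∧
      F₃ XH YV ZV = F ∧
      F₃ XH YH ZV = -(1 / 2) * R X (J Y) Z - 1 / 2 * R X Y (J Z) ∧
      F₃ XH YV ZH = 1 / 2 * R Z X (J Y) + 1 / 2 * R (J Z) X Y ∧
      F₃ XV YH ZH = 1 / 2 * R (J Y) Z X - 1 / 2 * R Y (J Z) X ∧
      F₃ XV YH ZV = 0 ∧ F₃ XV YV ZH = 0 ∧ F₃ XV YV ZV = 0) := by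
  intro R F J F₁ F₂ F₃ XH YH ZH XV YV ZV
  have hJY := S.isSmoothField_act hY
  have hJZ := S.isSmoothField_act hZ
  have hF := structuralTensor_base S (X := X) (Y := Y) (Z := Z) u.proj
  -- The table is needed for $(X,Y,Z)$, for $(X,JY,Z)$ from $J_\alpha B$, and for $(X,Y,JZ)$ from
  -- $J_\alpha$ moved onto the last slot.
  obtain ⟨a1, a2, a3, a4, a5, a6, a7, a8⟩ := sasaki_nabla_lifts S u hX hY hZ
  obtain ⟨b1, b2, b3, b4, b5, b6, b7, b8⟩ := sasaki_nabla_lifts S u hX hJY hZ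
  obtain ⟨c1, c2, c3, c4, c5, c6, c7, c8⟩ := sasaki_nabla_lifts S u hX hY hJZ
  have s1 := curvature₄_swap S hX hZ hY u.proj u.snd
  have s2 := curvature₄_swap S hX hZ hJY u.proj u.snd
  have s3 := curvature₄_swap S hX hJZ hY u.proj u.snd
  -- Bianchi enters only in $F_1(X^H,Y^H,Z^H)$ and $F_1(X^H,Y^V,Z^V)$, where
  -- $\tfrac12\bigl(R(X,Y,Z,u)+R(Z,X,Y,u)\bigr)$ or its negative must become a multiple of
  -- $R(Y,Z,X,u)$.
  have bi := curvature₄_bianchi S hX hY hZ u.proj u.snd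
  simp only [F₁, F₂, F₃, F, R, J, XH, YH, ZH, XV, YV, ZV, structuralTensor_sasaki,
    act_J₁_horizLift, act_J₁_vertLift, act_J₂_horizLift, act_J₂_vertLift, act_J₃_horizLift,
    act_J₃_vertLift, sasaki_nabla_neg_horizLift, sasaki_J₁_horizLift, sasaki_J₁_vertLift,
    sasaki_J₂_horizLift, sasaki_J₂_vertLift, sasaki_J₃_horizLift, sasaki_J₃_vertLift, hF]
  refine ⟨⟨?_, ?_, ?_, ?_, ?_, ?_, ?_, ?_⟩, ⟨?_, ?_, ?_, ?_, ?_, ?_, ?_, ?_⟩,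
    ⟨?_, ?_, ?_, ?_, ?_, ?_, ?_, ?_⟩⟩ <;> linarith
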